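/- Let $n\ge 1$. A rooted tree on $[n]=\{1,\dots,n\}$ is a rooted labelled tree whose node set is $[n]$. For a node $x$ of such a tree $T$, let $T_x$ be the subtree consisting of $x$ and all its descendants, let $\beta(x)$ be the smallest node of $T_x$ and let $\deg(x)$ be the number of children of $x$. An edge with father node $x$ and child node $y$ is *proper* if $x<\beta(y)$ and *improper* otherwise. Let $\mathcal R_{n,k}^{(i)}$ be the set of rooted trees on $[n]$ that have exactly $k$ improper edges and exactly $i$ proper edges on the path from the node $n$ to the root. If $\deg(n)>0$, the *lower critical node* $\lambda=\lambda(T)$ is the first node $u\ne n$ on the path from $n$ to $\beta(n)$ such that $u$ is smaller than every node of $T_n$ that is not a node of $T_u$. If there is a proper edge on the path from $n$ to the root, the *upper critical node* $w$ of $T$ is the father node of the first such edge (starting from $n$), and the *lowering* $L(T)$ is obtained from $T$ by replacing $T_w$ by the same tree rerooted at $n$ (if no such edge exists, put $L(T)=T$). **Theorem.** Let $n\ge 1$, $m\ge 1$ and $k\ge 0$. (1) There is a bijection $$\mathcal R_{n,k}^{(0)}[\deg(1)=m]\ \longleftrightarrow\ \mathcal R_{n,k+m}^{(0)}[\deg(1)=0,\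 \deg(n)\ge m,\ \lambda>1].$$ (2) The $(m-1)$-fold iterate $L^{m-1}$ of the lowering restricts to a bijection $$\mathcal R_{n,k+1}^{(m-1)}[\deg(1)=0,\ \deg(n)>0,\ \lambda>1]\ \longrightarrow\ \mathcal R_{n,k+m}^{(0)}[\deg(1)=0,\ \deg(n)\ge m,\ \lambda>1].$$ (3) Consequently, the existence of the bijection in (1) is equivalent to the existence of a bijection $$\mathcal R_{n,k}^{(0)}[\deg(1)=m]\ \longleftrightarrow\ \mathcal R_{n,k+1}^{(m-1)}[\deg(n)>0,\ \deg(1)=0,\ \lambda>1].$$ -/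

import Mathlib

/-- A rooted labelled tree whose node set is all of `V`, given by its root and its father map
(the root is sent to itself): every node reaches the root by iterating the father map. -/
@[ext]
structure LabelledTree (V : Type*) where
  root : V
  parent : V → V
  parent_root : parent root = root
  reaches_root : ∀ v, ∃ j, parent^[j] v = root

namespace LabelledTree

section Basic

variable {V : Type*}

/-- `T.Desc z x`: the node `z` is a descendant of `x` (every node is a descendant of itself),
that is, `z` is a node of the subtree `T_x`. -/
def Desc (T : LabelledTree V) (z x : V) : Prop := ∃ j, T.parent^[j] z = x

/-- `deg(x)`: the number of children of `x`. -/
noncomputable def deg (T : LabelledTree V) (x : V) : ℕ :=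
  {y | y ≠ T.root ∧ T.parent y = x}.ncard

theorem desc_refl (T : LabelledTree V) (x : V) : T.Desc x x := ⟨0, rfl⟩

theorem Desc.trans {T : LabelledTree V} {x y z : V} (h : T.Desc x y) (h' : T.Desc y z) :
    T.Desc x z := by
  obtain ⟨i, rfl⟩ := h
  obtain ⟨j, rfl⟩ := h'
  exact ⟨j + i, by rw [Function.iterate_add_apply]⟩

theorem iterate_root (T : LabelledTree V) (j : ℕ) : T.parent^[j] T.root = T.root :=
  Function.iterate_fixed T.parent_root j

/-- Two nodes that have a common descendant are comparable. -/
theorem Desc.total {T : LabelledTree V} {x y z : V} (h : T.Desc x y) (h' : T.Desc x z) :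
    T.Desc y z ∨ T.Desc z y := by
  obtain ⟨i, rfl⟩ := h
  obtain ⟨j, rfl⟩ := h'
  rcases le_total i j with hij | hij
  · exact Or.inl ⟨j - i, by rw [← Function.iterate_add_apply]; congr 2; omega⟩
  · exact Or.inr ⟨i - j, by rw [← Function.iterate_add_apply]; congr 2; omega⟩

theorem eq_root_of_iterate_eq {T : LabelledTree V} {x : V} {p : ℕ} (hp : 0 < p)
    (h : T.parent^[p] x = x) : x = T.root := by
  obtain ⟨r, hr⟩ := T.reaches_root x
  have h1 : T.parent^[p * (r + 1)] x = x := by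
    rw [Function.iterate_mul]
    exact Function.iterate_fixed h _
  have h2 : p * (r + 1) = (p * (r + 1) - r) + r := by
    have : r + 1 ≤ p * (r + 1) := Nat.le_mul_of_pos_left _ hp
    omega
  rw [h2, Function.iterate_add_apply, hr, iterate_root] at h1
  exact h1.symm

theorem Desc.antisymm {T : LabelledTree V} {x y : V} (h : T.Desc x y) (h' : T.Desc y x) :
    x = y := by
  obtain ⟨i, rfl⟩ := h
  obtain ⟨j, hj⟩ := h'
  rcases Nat.eq_zero_or_pos i with rfl | hi
  · rfl
  · rw [← Function.iterate_add_apply] at hj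
    have := eq_root_of_iterate_eq (by omega) hj
    subst this
    rw [iterate_root]

/-- The child of `x` on the path from `x` down to its proper descendant `a`. -/
noncomputable def childToward (T : LabelledTree V) (a x : V) : V :=
  open Classical in
  if h : T.Desc a x then T.parent^[Nat.find h - 1] a else x

open Classical in
/-- The father map of the tree obtained from `T` by replacing the subtree `T_w` by the same
unrooted tree rooted at `a`, where `a` is a node of `T_w`: along the path from `a` up to `w`
the edges are reversed, and `a` takes the place of `w`. -/
noncomputable def rerootParent (T : LabelledTree V) (a w : V) (x : V) : V :=
  if x = a then (if w = T.root then a else T.parent w)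
  else if T.Desc a x ∧ T.Desc x w then T.childToward a x
  else T.parent x

theorem parent_childToward {T : LabelledTree V} {a x : V} (h : T.Desc a x) (hx : x ≠ a) :
    T.parent (T.childToward a x) = x := by
  classical
  have hpos : Nat.find h ≠ 0 := by
    intro h0
    have := Nat.find_spec h
    rw [h0] at this
    exact hx this.symm
  unfold childToward
  rw [dif_pos h, ← Function.iterate_succ_apply' T.parent]
  have h1 : (Nat.find h - 1).succ = Nat.find h := by omega
  rw [h1]
  exact Nat.find_spec h

theorem desc_childToward {T : LabelledTree V} {a x : V} (h : T.Desc a x) :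
    T.Desc a (T.childToward a x) := by
  classical
  unfold childToward
  rw [dif_pos h]
  exact ⟨_, rfl⟩

theorem desc_parent (T : LabelledTree V) (x : V) : T.Desc x (T.parent x) := ⟨1, rfl⟩

theorem desc_root (T : LabelledTree V) (x : V) : T.Desc x T.root := T.reaches_root x

theorem eq_root_of_desc {T : LabelledTree V} {x : V} (h : T.Desc T.root x) : x = T.root := by
  obtain ⟨j, rfl⟩ := h
  exact T.iterate_root j

section Reroot

variable (T : LabelledTree V) {a w : V}

/-- From each node outside `T_w` one reaches the old root without changes. -/
theorem reroot_reach_outside (haw : T.Desc a w) (j : ℕ) :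
    ∀ v, T.parent^[j] v = T.root → ¬ T.Desc v w →
      ∃ i, (T.rerootParent a w)^[i] v = T.root := by
  induction j with
  | zero => intro v hv _; exact ⟨0, hv⟩
  | succ j ih =>
    intro v hv hvw
    have hva : v ≠ a := by rintro rfl; exact hvw haw
    have hstep : T.rerootParent a w v = T.parent v := by
      unfold rerootParent
      rw [if_neg hva, if_neg (fun h => hvw h.2)]
    by_cases hpw : T.Desc (T.parent v) w
    · exact absurd ((T.desc_parent v).trans hpw) hvw
    · obtain ⟨i, hi⟩ := ih (T.parent v) (by rwa [← Function.iterate_succ_apply]) hpw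
      exact ⟨i + 1, by rw [Function.iterate_succ_apply, hstep, hi]⟩

/-- From each node on the path from `a` to `w` one reaches `a`. -/
theorem reroot_reach_path (j : ℕ) :
    ∀ v, T.parent^[j] a = v → T.Desc v w → ∃ i, (T.rerootParent a w)^[i] v = a := by
  induction j using Nat.strong_induction_on with
  | _ j ih =>
    classical
    intro v hv hvw
    by_cases hva : v = a
    · exact ⟨0, hva⟩
    have hd : T.Desc a v := ⟨j, hv⟩
    have hstep : T.rerootParent a w v = T.childToward a v := by
      unfold rerootParent
      rw [if_neg hva, if_pos ⟨hd, hvw⟩]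
    have hc : T.childToward a v = T.parent^[Nat.find hd - 1] a := by
      unfold childToward
      rw [dif_pos hd]
    have hle : Nat.find hd ≤ j := Nat.find_min' hd hv
    have hpos : Nat.find hd ≠ 0 := by
      intro h0
      have := Nat.find_spec hd
      rw [h0] at this
      exact hva this.symm
    have hcw : T.Desc (T.childToward a v) w :=
      Desc.trans (T.desc_parent _) (by rw [parent_childToward hd hva]; exact hvw)
    obtain ⟨i, hi⟩ := ih (Nat.find hd - 1) (by omega) _ hc.symm hcw
    exact ⟨i + 1, by rw [Function.iterate_succ_apply, hstep, hi]⟩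

/-- From each node of `T_w` one reaches `a`. -/
theorem reroot_reach_inside (haw : T.Desc a w) (j : ℕ) :
    ∀ v, T.parent^[j] v = w → ∃ i, (T.rerootParent a w)^[i] v = a := by
  induction j with
  | zero =>
    intro v hv
    obtain ⟨r, hr⟩ := haw
    have hv' : v = w := hv
    subst hv'
    exact T.reroot_reach_path r v hr (T.desc_refl v)
  | succ j ih =>
    intro v hv
    by_cases hva : v = a
    · exact ⟨0, hva⟩
    by_cases hav : T.Desc a v
    · obtain ⟨r, hr⟩ := hav
      exact T.reroot_reach_path r v hr ⟨j + 1, hv⟩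
    · have hstep : T.rerootParent a w v = T.parent v := by
        unfold rerootParent
        rw [if_neg hva, if_neg (fun h => hav h.1)]
      obtain ⟨i, hi⟩ := ih (T.parent v) (by rwa [← Function.iterate_succ_apply])
      exact ⟨i + 1, by rw [Function.iterate_succ_apply, hstep, hi]⟩

end Reroot

open Classical in
/-- The tree obtained from `T` by replacing the subtree `T_w` by the same unrooted tree rooted
at its node `a`. -/
noncomputable def reroot (T : LabelledTree V) (a w : V) (haw : T.Desc a w) :
    LabelledTree V where
  root := if w = T.root then a else T.root
  parent := T.rerootParent a w
  parent_root := by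
    by_cases hw : w = T.root
    · simp [hw, rerootParent]
    · have h1 : T.root ≠ a := by
        intro h
        rw [← h] at haw
        exact hw (eq_root_of_desc haw)
      have h2 : ¬ (T.Desc a T.root ∧ T.Desc T.root w) := fun h => hw (eq_root_of_desc h.2)
      rw [if_neg hw]
      unfold rerootParent
      rw [if_neg h1, if_neg h2, T.parent_root]
  reaches_root := by
    intro v
    by_cases hw : w = T.root
    · rw [if_pos hw]
      obtain ⟨j, hj⟩ := T.reaches_root v
      exact T.reroot_reach_inside haw j v (hj.trans hw.symm)
    · rw [if_neg hw]
      by_cases hvw : T.Desc v w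
      · obtain ⟨j, hj⟩ := hvw
        obtain ⟨i, hi⟩ := T.reroot_reach_inside haw j v hj
        have hout : ¬ T.Desc (T.parent w) w := by
          intro h
          obtain ⟨p, hp⟩ := h
          rw [← Function.iterate_succ_apply] at hp
          exact hw (eq_root_of_iterate_eq (Nat.succ_pos p) hp)
        have hstep : T.rerootParent a w a = T.parent w := by
          simp [rerootParent, hw]
        obtain ⟨r, hr⟩ := T.reaches_root (T.parent w)
        obtain ⟨s, hs⟩ := T.reroot_reach_outside haw r _ hr hout
        refine ⟨s + 1 + i, ?_⟩
        rw [Function.iterate_add_apply, hi, Function.iterate_succ_apply, hstep, hs]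
      · obtain ⟨r, hr⟩ := T.reaches_root v
        exact T.reroot_reach_outside haw r v hr hvw

end Basic

section Ordered

variable {V : Type*} [LinearOrder V] [Fintype V]

open Classical in
/-- `β(x)`: the smallest node of the subtree `T_x`. -/
noncomputable def beta (T : LabelledTree V) (x : V) : V :=
  (Finset.univ.filter fun z => T.Desc z x).min' ⟨x, by simpa using T.desc_refl x⟩

/-- The edge with child node `y` (so `y` is not the root) is proper if its father node is
smaller than `β(y)`. -/
def ProperEdge (T : LabelledTree V) (y : V) : Prop :=
  y ≠ T.root ∧ T.parent y < T.beta y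

/-- The edge with child node `y` is improper. -/
def ImproperEdge (T : LabelledTree V) (y : V) : Prop :=
  y ≠ T.root ∧ ¬ T.parent y < T.beta y

/-- The number of improper edges. -/
noncomputable def improperCount (T : LabelledTree V) : ℕ := {y | T.ImproperEdge y}.ncard

/-- The number of proper edges on the path from `x` to the root. -/
noncomputable def properOnPath (T : LabelledTree V) (x : V) : ℕ :=
  {y | T.Desc x y ∧ T.ProperEdge y}.ncard

/-- `u` lies on the path from the largest node `⊤` to `β(⊤)`, is different from `⊤`, and is
smaller than every node of `T_⊤ - T_u`. -/
def LowerCandidate [BoundedOrder V] (T : LabelledTree V) (u : V) : Prop :=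
  u ≠ ⊤ ∧ T.Desc u ⊤ ∧ T.Desc (T.beta ⊤) u ∧ ∀ z, T.Desc z ⊤ → ¬ T.Desc z u → u < z

/-- `u` is the lower critical node `λ(T)`: the first candidate on the path from `⊤` to
`β(⊤)`. -/
def IsLowerCritical [BoundedOrder V] (T : LabelledTree V) (u : V) : Prop :=
  T.LowerCandidate u ∧ ∀ u', T.LowerCandidate u' → T.Desc u' u

/-- `w` is the upper critical node: the father node of the first proper edge on the path from
the largest node `⊤` to the root. -/
def IsUpperCritical [BoundedOrder V] (T : LabelledTree V) (w : V) : Prop :=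
  ∃ y, (T.Desc ⊤ y ∧ T.ProperEdge y) ∧
    (∀ y', T.Desc ⊤ y' ∧ T.ProperEdge y' → T.Desc y y') ∧ T.parent y = w

theorem IsUpperCritical.desc [BoundedOrder V] {T : LabelledTree V} {w : V}
    (h : T.IsUpperCritical w) : T.Desc ⊤ w := by
  obtain ⟨y, ⟨hy, _⟩, _, rfl⟩ := h
  exact hy.trans (T.desc_parent y)

open Classical in
/-- The lowering of `T`: the subtree at the upper critical node is rerooted at the largest node
`⊤`. A tree without upper critical node (no proper edge between `⊤` and the root) is left
alone. -/
noncomputable def lower [BoundedOrder V] (T : LabelledTree V) : LabelledTree V :=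
  if h : ∃ w, T.IsUpperCritical w then T.reroot ⊤ h.choose h.choose_spec.desc else T

theorem beta_desc (T : LabelledTree V) (x : V) : T.Desc (T.beta x) x := by
  classical
  have := Finset.min'_mem (Finset.univ.filter fun z => T.Desc z x)
    ⟨x, by simpa using T.desc_refl x⟩
  simpa [beta] using this

theorem beta_le (T : LabelledTree V) {z x : V} (h : T.Desc z x) : T.beta x ≤ z := by
  classical
  exact Finset.min'_le _ _ (by simpa using h)

/-- The lower critical node exists and is unique as soon as `⊤` has a child. -/
theorem existsUnique_isLowerCritical [BoundedOrder V] (T : LabelledTree V)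
    (h : 0 < T.deg ⊤) : ∃! u, T.IsLowerCritical u := by
  classical
  have hne : T.beta ⊤ ≠ ⊤ := by
    obtain ⟨y, hy, hp⟩ := Set.nonempty_of_ncard_ne_zero (ne_of_gt h)
    have hyt : y ≠ ⊤ := by
      rintro rfl
      exact hy (eq_root_of_iterate_eq (p := 1) one_pos hp)
    have h1 : T.beta ⊤ ≤ y := T.beta_le ⟨1, hp⟩
    exact (lt_of_le_of_lt h1 (lt_top_iff_ne_top.mpr hyt)).ne
  have hb : T.LowerCandidate (T.beta ⊤) := by
    refine ⟨hne, T.beta_desc ⊤, T.desc_refl _, fun z hz hz' => ?_⟩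
    refine lt_of_le_of_ne (T.beta_le hz) ?_
    rintro rfl
    exact hz' (T.desc_refl _)
  -- a later candidate on the path is smaller, so the first one is the largest
  obtain ⟨u, hu, hmax⟩ := (Finset.univ.filter fun u => T.LowerCandidate u).exists_max_image id
    ⟨_, by simpa using hb⟩
  simp only [Finset.mem_filter, Finset.mem_univ, true_and, id] at hu hmax
  refine ⟨u, ⟨hu, fun u' hu' => ?_⟩, fun v hv => ?_⟩
  · by_contra hcon
    exact absurd (hu.2.2.2 u' hu'.2.1 hcon) (not_lt.mpr (hmax u' hu'))
  · have h1 : T.Desc u v := hv.2 u hu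
    by_contra hcon
    have h2 : ¬ T.Desc v u := fun h3 => hcon (h3.antisymm h1)
    exact absurd (hu.2.2.2 v hv.1.2.1 h2) (not_lt.mpr (hmax v hv.1))

/-- `λ > 1`: the lower critical node is not the smallest node. -/
def LowerCriticalGtOne [BoundedOrder V] (T : LabelledTree V) : Prop :=
  ∃ u, T.IsLowerCritical u ∧ ⊥ < u

end Ordered

end LabelledTree

/-- `𝓡_{n,k}^{(i)}`: the rooted trees on `n` labelled nodes with `k` improper edges and with
`i` proper edges on the path from the largest node to the root. The labels `1 < 2 < ⋯ < n` are
the elements of `Fin n`, so that the label `1` is `⊥` and the label `n` is `⊤`. -/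
def treesR (n k i : ℕ) [NeZero n] : Set (LabelledTree (Fin n)) :=
  {T | T.improperCount = k ∧ T.properOnPath ⊤ = i}

/-- `𝓡_{n,k}^{(0)}[deg(1) = m]`. -/
def treesDegOne (n k m : ℕ) [NeZero n] : Set (LabelledTree (Fin n)) :=
  {T | T ∈ treesR n k 0 ∧ T.deg ⊥ = m}

/-- `𝓡_{n,k}^{(i)}[deg(1) = 0, deg(n) ≥ d, λ > 1]`. -/
def treesLambda (n k i d : ℕ) [NeZero n] : Set (LabelledTree (Fin n)) :=
  {T | T ∈ treesR n k i ∧ T.deg ⊥ = 0 ∧ d ≤ T.deg ⊤ ∧ T.LowerCriticalGtOne}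

/-! Write `⊥` and `⊤` for the nodes 1 and n. Two independent surgeries carry the theorem.

Lowering. Let `w` and `y` be the father and the child of the first proper edge on the path from `⊤`
to the root. Rerooting `T_w` at `⊤` reverses the path from `⊤` to `w`. All reversed edges are
improper: the new subtree of the child contains `w`, while the father lies in `T_y`, whose nodes all
exceed `w`. So one proper edge of the path becomes improper, and `⊤` gains a child. The new tree
remembers `w` as its lower critical node, and rerooting there undoes the lowering
(`lower_isLowerCritical`, `IsLowerCritical.firstProper`, `bijOn_lower`). Iteration gives (2), and
composition with it gives (3).

Exchange. For (1) it remains to trade proper edges on the path for children of `⊥` without changing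
the number of improper edges. One step takes the last proper edge on the path, with father `w` and
child `y`, and the first node `q` from `w` upwards with `β(q) < w`. The node `y` takes the place of
`q` and receives the children `c` of `q` with `β(c) < w`; the rest of `T_q` becomes a subtree at
`⊥`, with new value `β(q) = w`. Fathers of proper edges on the path decrease towards the root, so
`w` is smaller than the father of each remaining proper edge, and successive steps add children of
`⊥` with increasing `β`. The last step is therefore read off from the child of `⊥` with the largest
`β`. The invariant is `separatedTrees`, and `nonempty_equiv_separatedTrees_succ` is one step. With m
steps, trees with m proper edges on the path and `deg ⊥ = 0` correspond to trees with none and `deg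
⊥ = m`; lowering the former m times yields (1). -/

namespace LabelledTree

/-! ### Ancestors and paths -/

section Ancestors

variable {V : Type*} {T : LabelledTree V}

theorem induction_parent (T : LabelledTree V) {P : V → Prop} (h0 : P T.root)
    (h : ∀ v, v ≠ T.root → P (T.parent v) → P v) (v : V) : P v := by
  obtain ⟨j, hj⟩ := T.reaches_root v
  induction j generalizing v with
  | zero => exact (show v = T.root from hj) ▸ h0
  | succ j ih =>
    by_cases hv : v = T.root
    · exact hv ▸ h0
    · exact h v hv (ih _ (by rwa [← Function.iterate_succ_apply]))

theorem desc_iff_eq_or_parent {v z : V} : T.Desc v z ↔ v = z ∨ T.Desc (T.parent v) z := by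
  constructor
  · rintro ⟨j, rfl⟩
    rcases j with _ | j
    · exact Or.inl rfl
    · exact Or.inr ⟨j, by rw [← Function.iterate_succ_apply]⟩
  · rintro (rfl | h)
    · exact T.desc_refl _
    · exact (T.desc_parent v).trans h

theorem Desc.parent {v z : V} (h : T.Desc v z) (hne : v ≠ z) : T.Desc (T.parent v) z :=
  (desc_iff_eq_or_parent.1 h).resolve_left hne

theorem not_desc_parent {v : V} (hv : v ≠ T.root) : ¬ T.Desc (T.parent v) v := by
  rintro ⟨p, hp⟩
  rw [← Function.iterate_succ_apply] at hp
  exact hv (eq_root_of_iterate_eq (Nat.succ_pos p) hp)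

theorem parent_ne {v : V} (hv : v ≠ T.root) : T.parent v ≠ v := fun h =>
  not_desc_parent hv (h.symm ▸ T.desc_refl v)

theorem ne_root_of_parent_ne {v : V} (h : T.parent v ≠ v) : v ≠ T.root := by
  rintro rfl
  exact h T.parent_root

theorem childToward_ne_root {v z : V} (h : T.Desc v z) (hne : v ≠ z) :
    T.childToward v z ≠ T.root := by
  classical
  intro hr
  have h1 := parent_childToward h hne.symm
  rw [hr, T.parent_root] at h1
  have h2 := hr.trans h1
  unfold childToward at h2
  rw [dif_pos h] at h2
  have hpos : Nat.find h ≠ 0 := by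
    intro h0
    have := Nat.find_spec h
    rw [h0] at this
    exact hne this
  -- A root in this position would equal `z`, one step before `z` is first reached.
  exact Nat.find_min h (by omega) h2

theorem exists_child_of_desc {v z : V} (h : T.Desc v z) (hne : v ≠ z) :
    ∃ c, c ≠ T.root ∧ T.parent c = z ∧ T.Desc v c :=
  ⟨T.childToward v z, childToward_ne_root h hne, parent_childToward h hne.symm,
    desc_childToward h⟩

/-- The children of `z` have disjoint subtrees. -/
theorem child_unique {v z c d : V} (hc : c ≠ T.root) (hcz : T.parent c = z) (hvc : T.Desc v c)
    (hd : d ≠ T.root) (hdz : T.parent d = z) (hvd : T.Desc v d) : c = d := by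
  by_contra hne
  rcases hvc.total hvd with h | h
  · exact not_desc_parent hd (hdz ▸ hcz ▸ h.parent hne)
  · exact not_desc_parent hc (hcz ▸ hdz ▸ h.parent (Ne.symm hne))

theorem childToward_eq {v z c : V} (hc : c ≠ T.root) (hcz : T.parent c = z)
    (hvc : T.Desc v c) : T.childToward v z = c := by
  have h : T.Desc v z := hvc.trans (hcz ▸ T.desc_parent c)
  have hne : v ≠ z := by
    rintro rfl
    exact not_desc_parent hc (hcz ▸ hvc)
  exact child_unique (childToward_ne_root h hne) (parent_childToward h hne.symm)
    (desc_childToward h) hc hcz hvc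

/-- The ancestors of `z` are characterised by how they propagate along the father map. -/
theorem desc_iff_of_local {z : V} {P : V → Prop} (h0 : P T.root ↔ T.root = z)
    (h : ∀ v, v ≠ T.root → (P v ↔ v = z ∨ P (T.parent v))) (v : V) : T.Desc v z ↔ P v := by
  induction v using T.induction_parent with
  | h0 =>
    rw [h0]
    exact ⟨fun h => (eq_root_of_desc h).symm, fun h => h ▸ T.desc_refl _⟩
  | h v hv ih => rw [desc_iff_eq_or_parent, h v hv, ih]

/-- Two trees whose father maps agree on the path from `v` to its ancestor `u`, except
possibly at `u`, have the same such path. -/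
theorem desc_iff_of_agree {T' : LabelledTree V} {v u z : V} (hvu : T.Desc v u)
    (h : ∀ x, T.Desc v x → T.Desc x u → x ≠ u → T'.parent x = T.parent x) :
    T'.Desc v z ↔ (T.Desc v z ∧ T.Desc z u) ∨ T'.Desc u z := by
  obtain ⟨j, hj⟩ := hvu
  induction j generalizing v with
  | zero =>
    obtain rfl : v = u := hj
    constructor
    · exact Or.inr
    · rintro (⟨h1, h2⟩ | h1)
      · exact h1.antisymm h2 ▸ T'.desc_refl _
      · exact h1
  | succ j ih =>
    by_cases hvu : v = u
    · subst hvu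
      constructor
      · exact Or.inr
      · rintro (⟨h1, h2⟩ | h1)
        · exact h1.antisymm h2 ▸ T'.desc_refl _
        · exact h1
    · have hd : T.Desc v u := ⟨_, hj⟩
      rw [desc_iff_eq_or_parent, h v (T.desc_refl v) hd hvu,
        ih (fun x hx => h x ((T.desc_parent v).trans hx))
          (by rwa [← Function.iterate_succ_apply]), desc_iff_eq_or_parent (T := T) (v := v)]
      constructor
      · rintro (rfl | h1 | h1)
        · exact Or.inl ⟨Or.inl rfl, hd⟩
        · exact Or.inl ⟨Or.inr h1.1, h1.2⟩
        · exact Or.inr h1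
      · rintro (⟨rfl | h1, h2⟩ | h1)
        · exact Or.inl rfl
        · exact Or.inr (Or.inl ⟨h1, h2⟩)
        · exact Or.inr (Or.inr h1)

/-- Two trees whose father maps agree on the path from `v` to the root of the first one. -/
theorem desc_iff_of_agree_root {T' : LabelledTree V} {v z : V}
    (h : ∀ x, T.Desc v x → T'.parent x = T.parent x) : T'.Desc v z ↔ T.Desc v z := by
  have key : ∀ j, T'.parent^[j] v = T.parent^[j] v := by
    intro j
    induction j with
    | zero => rfl
    | succ j ih =>
      rw [Function.iterate_succ_apply', Function.iterate_succ_apply', ih, h _ ⟨j, rfl⟩]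
  simp only [Desc, key]

theorem wellFounded_desc_ne [Finite V] (T : LabelledTree V) :
    WellFounded fun v z => T.Desc v z ∧ v ≠ z := by
  have : IsTrans V fun v z => T.Desc v z ∧ v ≠ z :=
    ⟨fun a b c h1 h2 => ⟨h1.1.trans h2.1, fun h => h1.2 (h1.1.antisymm (h ▸ h2.1))⟩⟩
  have : Std.Irrefl fun v z => T.Desc v z ∧ v ≠ z := ⟨fun a h => h.2 rfl⟩
  exact Finite.wellFounded_of_trans_of_irrefl _

theorem wellFounded_desc_ne_flip [Finite V] (T : LabelledTree V) :
    WellFounded fun v z => T.Desc z v ∧ z ≠ v := by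
  have : IsTrans V fun v z => T.Desc z v ∧ z ≠ v :=
    ⟨fun a b c h1 h2 => ⟨h2.1.trans h1.1, fun h => h2.2 (h2.1.antisymm (h ▸ h1.1))⟩⟩
  have : Std.Irrefl fun v z => T.Desc z v ∧ z ≠ v := ⟨fun a h => h.2 rfl⟩
  exact Finite.wellFounded_of_trans_of_irrefl _

theorem exists_first_ancestor [Finite V] {v : V} {P : V → Prop} (h : ∃ z, T.Desc v z ∧ P z) :
    ∃ z, (T.Desc v z ∧ P z) ∧ ∀ z', T.Desc v z' ∧ P z' → T.Desc z z' := by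
  obtain ⟨z, hz, hmin⟩ := T.wellFounded_desc_ne.has_min {z | T.Desc v z ∧ P z} h
  refine ⟨z, hz, fun z' hz' => ?_⟩
  rcases hz.1.total hz'.1 with hd | hd
  · exact hd
  · by_cases he : z' = z
    · exact he ▸ T.desc_refl _
    · exact absurd ⟨hd, he⟩ (hmin z' hz')

theorem exists_last_ancestor [Finite V] {v : V} {P : V → Prop} (h : ∃ z, T.Desc v z ∧ P z) :
    ∃ z, (T.Desc v z ∧ P z) ∧ ∀ z', T.Desc v z' ∧ P z' → T.Desc z' z := by
  obtain ⟨z, hz, hmin⟩ := T.wellFounded_desc_ne_flip.has_min {z | T.Desc v z ∧ P z} h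
  refine ⟨z, hz, fun z' hz' => ?_⟩
  rcases hz.1.total hz'.1 with hd | hd
  · by_cases he : z = z'
    · exact he ▸ T.desc_refl _
    · exact absurd ⟨hd, he⟩ (hmin z' hz')
  · exact hd

end Ancestors

/-! ### The minimum `β` of a subtree -/

section Beta

variable {V : Type*} [LinearOrder V] [Fintype V] {T : LabelledTree V}

theorem beta_le_self (T : LabelledTree V) (z : V) : T.beta z ≤ z := T.beta_le (T.desc_refl z)

theorem beta_anti {v z : V} (h : T.Desc v z) : T.beta z ≤ T.beta v :=
  T.beta_le ((T.beta_desc v).trans h)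

theorem beta_parent_le (T : LabelledTree V) (z : V) : T.beta (T.parent z) ≤ T.beta z :=
  beta_anti (T.desc_parent z)

theorem beta_eq_self_or_child (T : LabelledTree V) (z : V) :
    T.beta z = z ∨ ∃ c, c ≠ T.root ∧ T.parent c = z ∧ T.beta c = T.beta z := by
  by_cases h : T.beta z = z
  · exact Or.inl h
  · obtain ⟨c, hc, hcz, hd⟩ := exists_child_of_desc (T.beta_desc z) h
    exact Or.inr ⟨c, hc, hcz, le_antisymm (T.beta_le hd) (hcz ▸ T.beta_parent_le c)⟩

/-- The function `β` is characterised by its local behaviour along the edges. -/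
theorem beta_eq_of_local {g : V → V} (h1 : ∀ z, g z ≤ z)
    (h2 : ∀ z, z ≠ T.root → g (T.parent z) ≤ g z)
    (h3 : ∀ z, g z = z ∨ ∃ c, c ≠ T.root ∧ T.parent c = z ∧ g c = g z) (z : V) :
    T.beta z = g z := by
  -- `h1` and `h2` make `g z` a lower bound on `T_z`. By `h3` it is attained: children with the same
  -- value of `g` lead down to a node fixed by `g`.
  have h4 : ∀ v, T.Desc v z → g z ≤ g v := by
    intro v
    induction v using T.induction_parent with
    | h0 => intro h; rw [eq_root_of_desc h]
    | h v hv ih =>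
      intro h
      rcases desc_iff_eq_or_parent.1 h with rfl | h
      · exact le_rfl
      · exact (ih h).trans (h2 v hv)
  refine le_antisymm ?_ ((h4 _ (T.beta_desc z)).trans (h1 _))
  clear h4
  induction z using T.wellFounded_desc_ne.induction with
  | _ z ih =>
    rcases h3 z with h | ⟨c, hc, hcz, he⟩
    · exact h.symm ▸ T.beta_le_self z
    · have := ih c ⟨hcz ▸ T.desc_parent c, fun h => parent_ne hc (hcz.trans h.symm)⟩
      calc T.beta z ≤ T.beta c := hcz ▸ T.beta_parent_le c
        _ ≤ g z := he ▸ this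

theorem beta_eq_bot [BoundedOrder V] {z : V} (h : T.Desc ⊥ z) : T.beta z = ⊥ :=
  le_bot_iff.1 (T.beta_le h)

end Beta

end LabelledTree

namespace LabelledTree

/-! ### The exchange of two subtrees -/

section Exchange

variable {V : Type*} [LinearOrder V] [Fintype V]

/-- The conditions under which `exchange` yields a tree whose improper edges are controlled. -/
structure Exchangeable (T : LabelledTree V) (a b x w : V) : Prop where
  not_desc : ¬ T.Desc a b
  proper : T.ProperEdge b
  beta_lt : T.beta a < w
  le : w ≤ a
  le_beta : w ≤ T.beta b
  -- The new father `x` of `a` must lie outside the part of `T_a` that stays with `a`, or a cycle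
  -- would arise.
  reach : ¬ T.Desc x a ∨ (∃ c, c ≠ a ∧ T.parent c = a ∧ T.beta c < w ∧ T.Desc x c) ∨ T.Desc x b
  lt : x < a
  lt_beta : ∀ c, c ≠ a → c ≠ b → T.parent c = a → w ≤ T.beta c → x < T.beta c

open Classical in
/-- The father map of `exchange`. -/
noncomputable def exchangeParent (T : LabelledTree V) (a b x w z : V) : V :=
  if z = b then (if a = T.root then b else T.parent a)
  else if z = a then x
  else if T.parent z = a ∧ T.beta z < w then b
  else T.parent z

variable {T : LabelledTree V} {a b x w : V}

open Classical in
theorem exchangeParent_of_ne {z : V} (hza : z ≠ a) (hzb : z ≠ b) :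
    T.exchangeParent a b x w z = if T.parent z = a ∧ T.beta z < w then b else T.parent z := by
  unfold exchangeParent
  rw [if_neg hzb, if_neg hza]

theorem exchange_reach_of_step {r v : V} (hv : ∃ i, (T.exchangeParent a b x w)^[i]
      (T.exchangeParent a b x w v) = r) :
    ∃ i, (T.exchangeParent a b x w)^[i] v = r := by
  obtain ⟨i, hi⟩ := hv
  exact ⟨i + 1, by rw [Function.iterate_succ_apply, hi]⟩

namespace Exchangeable

variable (h : T.Exchangeable a b x w)
include h

theorem ne : a ≠ b := fun he => h.not_desc (he ▸ T.desc_refl a)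

theorem ne_root : b ≠ T.root := h.proper.1

theorem exchangeParent_left : T.exchangeParent a b x w a = x := by
  simp [exchangeParent, h.ne]

theorem not_desc_parent_left (ha : a ≠ T.root) :
    ¬ T.Desc (T.parent a) a ∧ ¬ T.Desc (T.parent a) b :=
  ⟨not_desc_parent ha, fun hd => h.not_desc ((T.desc_parent a).trans hd)⟩

theorem reach_of_outside (v : V) : ¬ T.Desc v a → ¬ T.Desc v b →
    ∃ i, (T.exchangeParent a b x w)^[i] v = if a = T.root then b else T.root := by
  induction v using T.induction_parent with
  | h0 =>
    intro h1 _
    have ha : a ≠ T.root := by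
      rintro rfl
      exact h1 (T.desc_refl _)
    exact ⟨0, by simp [ha]⟩
  | h v hv ih =>
    intro h1 h2
    have hp : T.exchangeParent a b x w v = T.parent v := by
      unfold exchangeParent
      rw [if_neg (fun he : v = b => h2 (he ▸ T.desc_refl v)),
        if_neg (fun he : v = a => h1 (he ▸ T.desc_refl v)),
        if_neg (fun he : T.parent v = a ∧ _ => h1 (he.1 ▸ T.desc_parent v))]
    obtain ⟨i, hi⟩ := ih (fun hd => h1 ((T.desc_parent v).trans hd))
      (fun hd => h2 ((T.desc_parent v).trans hd))
    exact ⟨i + 1, by rw [Function.iterate_succ_apply, hp, hi]⟩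

theorem reach_right :
    ∃ i, (T.exchangeParent a b x w)^[i] b = if a = T.root then b else T.root := by
  by_cases ha : a = T.root
  · exact ⟨0, by simp [ha]⟩
  · obtain ⟨i, hi⟩ := h.reach_of_outside _ (h.not_desc_parent_left ha).1
      (h.not_desc_parent_left ha).2
    exact ⟨i + 1, by rw [Function.iterate_succ_apply]; simpa [exchangeParent, ha] using hi⟩

/-- These nodes do not stay with `a`, so their new path avoids `a`. This is what shows that the new
edge from `a` to `x` closes no cycle. -/
theorem reach_of_good (v : V) :
    (¬ T.Desc v a ∨ (∃ c, c ≠ a ∧ T.parent c = a ∧ T.beta c < w ∧ T.Desc v c) ∨ T.Desc v b) →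
    ∃ i, (T.exchangeParent a b x w)^[i] v = if a = T.root then b else T.root := by
  induction v using T.induction_parent with
  | h0 =>
    intro h1
    have hb : ¬ T.Desc T.root b := fun hd => h.ne_root (eq_root_of_desc hd)
    by_cases ha : a = T.root
    · rcases h1 with h1 | ⟨c, hc, _, _, hd⟩ | h1
      · exact absurd (ha ▸ T.desc_refl _) h1
      · exact absurd ((eq_root_of_desc hd).trans ha.symm) hc
      · exact absurd h1 hb
    · exact h.reach_of_outside _ (fun hd => ha (eq_root_of_desc hd)) hb
  | h v hv ih =>
    intro h1
    by_cases hvb : v = b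
    · exact hvb ▸ h.reach_right
    apply exchange_reach_of_step
    by_cases hva : v = a
    · subst hva
      rcases h1 with h1 | ⟨c, hc, hcv, _, hd⟩ | h1
      · exact absurd (T.desc_refl v) h1
      · exact absurd ((hcv ▸ T.desc_parent c : T.Desc c v).antisymm hd) hc
      · exact absurd h1 h.not_desc
    rw [exchangeParent_of_ne hva hvb]
    by_cases hR : T.parent v = a ∧ T.beta v < w
    · rw [if_pos hR]
      exact h.reach_right
    · rw [if_neg hR]
      apply ih
      rcases h1 with h1 | ⟨c, hc, hcv, hcw, hd⟩ | h1
      · exact Or.inl fun hd => h1 ((T.desc_parent v).trans hd)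
      · refine Or.inr (Or.inl ⟨c, hc, hcv, hcw, hd.parent ?_⟩)
        rintro rfl
        exact hR ⟨hcv, hcw⟩
      · exact Or.inr (Or.inr (h1.parent hvb))

theorem reach_all (v : V) :
    ∃ i, (T.exchangeParent a b x w)^[i] v = if a = T.root then b else T.root := by
  induction v using T.induction_parent with
  | h0 =>
    by_cases ha : a = T.root
    · apply exchange_reach_of_step
      rw [← ha, h.exchangeParent_left, ha]
      simpa [ha] using h.reach_of_good x h.reach
    · exact h.reach_of_outside _ (fun hd => ha (eq_root_of_desc hd))
        (fun hd => h.ne_root (eq_root_of_desc hd))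
  | h v hv ih =>
    by_cases hvb : v = b
    · exact hvb ▸ h.reach_right
    apply exchange_reach_of_step
    by_cases hva : v = a
    · rw [hva, h.exchangeParent_left]
      exact h.reach_of_good x h.reach
    rw [exchangeParent_of_ne hva hvb]
    by_cases hR : T.parent v = a ∧ T.beta v < w
    · rw [if_pos hR]
      exact h.reach_right
    · rw [if_neg hR]
      exact ih

end Exchangeable

open Classical in
/-- The node `b` takes the place of `a`, together with the children `c` of `a` that satisfy
`β(c) < w`, and `a`, with its other children, becomes a child of `x`. -/
noncomputable def exchange (T : LabelledTree V) (a b x w : V) (h : T.Exchangeable a b x w) :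
    LabelledTree V where
  root := if a = T.root then b else T.root
  parent := T.exchangeParent a b x w
  parent_root := by
    by_cases ha : a = T.root
    · simp [exchangeParent, ha]
    · rw [if_neg ha]
      have hr : ¬ (T.parent T.root = a ∧ T.beta T.root < w) := fun he =>
        ha (he.1.symm.trans T.parent_root)
      unfold exchangeParent
      rw [if_neg h.ne_root.symm, if_neg (Ne.symm ha), if_neg hr, T.parent_root]
  reaches_root := h.reach_all

namespace Exchangeable

variable (h : T.Exchangeable a b x w)

theorem root_eq : (T.exchange a b x w h).root = if a = T.root then b else T.root := rfl

theorem parent_right :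
    (T.exchange a b x w h).parent b = if a = T.root then b else T.parent a := by
  simp [exchange, exchangeParent]

theorem parent_left : (T.exchange a b x w h).parent a = x := h.exchangeParent_left

theorem parent_of_lt {z : V} (hza : z ≠ a) (hz : T.parent z = a) (hw : T.beta z < w) :
    (T.exchange a b x w h).parent z = b := by
  have hzb : z ≠ b := by
    rintro rfl
    exact absurd h.le_beta (not_le.2 hw)
  simp [exchange, exchangeParent, hza, hzb, hz, hw]

theorem parent_of_not {z : V} (hza : z ≠ a) (hzb : z ≠ b)
    (hz : ¬ (T.parent z = a ∧ T.beta z < w)) :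
    (T.exchange a b x w h).parent z = T.parent z := by
  simp only [exchange, exchangeParent, if_neg hza, if_neg hzb, if_neg hz]

theorem parent_of_ne {z : V} (hza : z ≠ a) (hzb : z ≠ b) (hz : T.parent z ≠ a) :
    (T.exchange a b x w h).parent z = T.parent z :=
  h.parent_of_not hza hzb fun hh => hz hh.1

theorem parent_of_le {z : V} (hza : z ≠ a) (hzb : z ≠ b) (hz : w ≤ T.beta z) :
    (T.exchange a b x w h).parent z = T.parent z :=
  h.parent_of_not hza hzb fun hh => absurd hz (not_le.2 hh.2)

theorem ne_root_iff {z : V} (hza : z ≠ a) (hzb : z ≠ b) :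
    z ≠ (T.exchange a b x w h).root ↔ z ≠ T.root := by
  rw [root_eq]
  split_ifs with ha
  · exact iff_of_true hzb (ha ▸ hza)
  · rfl

theorem left_ne_root : a ≠ (T.exchange a b x w h).root := by
  rw [root_eq]
  split_ifs with ha
  · exact h.ne
  · exact ha

theorem right_ne_root_iff : b ≠ (T.exchange a b x w h).root ↔ a ≠ T.root := by
  rw [root_eq]
  split_ifs with ha
  · simp [ha]
  · exact iff_of_true h.ne_root ha

-- Here `m` is the minimum of `a` and of `β` over the children that stay with `a`. The value `β(a)`
-- comes through a child that moves to `b`, so `b` inherits it. Nothing else changes, because a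
-- proper edge (the old one above `b`, the new one above `a`) never passes a minimum on to its
-- father.
open Classical in
theorem exists_beta : ∃ m,
    (∀ z, (T.exchange a b x w h).beta z = if z = a then m else if z = b then T.beta a
      else T.beta z) ∧ w ≤ m ∧ x < m ∧ m ≤ a ∧
    (∀ c, c ≠ a → c ≠ b → T.parent c = a → w ≤ T.beta c → m ≤ T.beta c) ∧
    (m = a ∨ ∃ c, c ≠ a ∧ c ≠ b ∧ T.parent c = a ∧ w ≤ T.beta c ∧ T.beta c = m) := by
  obtain ⟨m, hm, hmin⟩ := (insert a ((Finset.univ.filter fun c =>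
    c ≠ a ∧ c ≠ b ∧ T.parent c = a ∧ w ≤ T.beta c).image T.beta)).exists_min_image id
      ⟨a, Finset.mem_insert_self _ _⟩
  have hma : m ≤ a := hmin a (Finset.mem_insert_self _ _)
  have hmc : ∀ c, c ≠ a → c ≠ b → T.parent c = a → w ≤ T.beta c → m ≤ T.beta c :=
    fun c h1 h2 h3 h4 => hmin _ (Finset.mem_insert_of_mem (Finset.mem_image_of_mem _
      (by simp [h1, h2, h3, h4])))
  have hm' : m = a ∨ ∃ c, c ≠ a ∧ c ≠ b ∧ T.parent c = a ∧ w ≤ T.beta c ∧ T.beta c = m := by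
    rcases Finset.mem_insert.1 hm with hm | hm
    · exact Or.inl hm
    · obtain ⟨c, hc, rfl⟩ := Finset.mem_image.1 hm
      have hc := (Finset.mem_filter.1 hc).2
      exact Or.inr ⟨c, hc.1, hc.2.1, hc.2.2.1, hc.2.2.2, rfl⟩
  have hwm : w ≤ m := by
    rcases hm' with rfl | ⟨c, _, _, _, hc, rfl⟩
    exacts [h.le, hc]
  have hxm : x < m := by
    rcases hm' with rfl | ⟨c, h1, h2, h3, h4, rfl⟩
    exacts [h.lt, h.lt_beta c h1 h2 h3 h4]
  refine ⟨m, fun z => ?_, hwm, hxm, hma, hmc, hm'⟩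
  set g : V → V := fun z => if z = a then m else if z = b then T.beta a else T.beta z with hg
  have ga : g a = m := by simp [hg]
  have gb : g b = T.beta a := by simp [hg, h.ne.symm]
  have gz : ∀ {z}, z ≠ a → z ≠ b → g z = T.beta z := fun h1 h2 => by simp [hg, h1, h2]
  have g1 : ∀ z, g z ≤ z := by
    intro z
    by_cases hza : z = a
    · rw [hza, ga]; exact hma
    by_cases hzb : z = b
    · rw [hzb, gb]
      exact (h.beta_lt.le.trans h.le_beta).trans (T.beta_le_self b)
    · rw [gz hza hzb]; exact T.beta_le_self z
  refine beta_eq_of_local (g := g) g1 (fun z hz => ?_) (fun z => ?_) z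
  · by_cases hza : z = a
    · subst hza
      rw [h.parent_left, ga]
      exact (g1 x).trans hxm.le
    by_cases hzb : z = b
    · subst hzb
      have ha := h.right_ne_root_iff.1 hz
      have hn := h.not_desc_parent_left ha
      rw [h.parent_right, if_neg ha, gb, gz (parent_ne ha)
        (fun he => h.not_desc (he ▸ T.desc_parent a))]
      exact T.beta_parent_le a
    rw [gz hza hzb]
    by_cases hR : T.parent z = a ∧ T.beta z < w
    · rw [h.parent_of_lt hza hR.1 hR.2, gb, ← hR.1]
      exact T.beta_parent_le z
    · rw [h.parent_of_not hza hzb hR]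
      by_cases hpa : T.parent z = a
      · rw [hpa, ga]
        exact hmc z hza hzb hpa (not_lt.1 fun hh => hR ⟨hpa, hh⟩)
      by_cases hpb : T.parent z = b
      · rw [hpb, gb]
        exact (h.beta_lt.le.trans h.le_beta).trans (hpb ▸ T.beta_parent_le z)
      · rw [gz hpa hpb]
        exact T.beta_parent_le z
  · by_cases hza : z = a
    · subst hza
      rcases hm' with rfl | ⟨c, h1, h2, h3, h4, h5⟩
      · exact Or.inl ga
      · refine Or.inr ⟨c, (h.ne_root_iff h1 h2).2 ?_, ?_, ?_⟩
        · rintro rfl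
          exact h1 (T.parent_root.symm.trans h3)
        · rw [h.parent_of_le h1 h2 h4, h3]
        · rw [gz h1 h2, ga, h5]
    by_cases hzb : z = b
    · subst hzb
      rcases T.beta_eq_self_or_child a with ha | ⟨c, h1, h2, h3⟩
      · exact absurd (ha ▸ h.beta_lt) (not_lt.2 h.le)
      · have hlt : T.beta c < w := h3 ▸ h.beta_lt
        have hca : c ≠ a := fun he => parent_ne h1 (h2.trans he.symm)
        have hcb : c ≠ z := by
          rintro rfl
          exact absurd h.le_beta (not_le.2 hlt)
        exact Or.inr ⟨c, (h.ne_root_iff hca hcb).2 h1, h.parent_of_lt hca h2 hlt, by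
          rw [gz hca hcb, gb, h3]⟩
    rw [gz hza hzb]
    rcases T.beta_eq_self_or_child z with hz | ⟨c, h1, h2, h3⟩
    · exact Or.inl hz
    · right
      by_cases hca : c = a
      · subst hca
        exact ⟨b, h.right_ne_root_iff.2 h1, by rw [h.parent_right, if_neg h1, h2], by
          rw [gb, h3]⟩
      have hcb : c ≠ b := by
        rintro rfl
        have := (T.beta_le_self z).trans_lt (h2 ▸ h.proper.2)
        exact absurd h3 this.ne'
      exact ⟨c, (h.ne_root_iff hca hcb).2 h1, by
        rw [h.parent_of_ne hca hcb (h2 ▸ hza), h2], by rw [gz hca hcb, h3]⟩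

theorem beta_right : (T.exchange a b x w h).beta b = T.beta a := by
  obtain ⟨m, hm, -⟩ := h.exists_beta
  simp [hm, h.ne.symm]

theorem beta_of_ne {z : V} (hza : z ≠ a) (hzb : z ≠ b) :
    (T.exchange a b x w h).beta z = T.beta z := by
  obtain ⟨m, hm, -⟩ := h.exists_beta
  simp [hm, hza, hzb]

theorem le_beta_left : w ≤ (T.exchange a b x w h).beta a := by
  obtain ⟨m, hm, h1, -⟩ := h.exists_beta
  simpa [hm] using h1

theorem lt_beta_left : x < (T.exchange a b x w h).beta a := by
  obtain ⟨m, hm, _, h1, -⟩ := h.exists_beta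
  simpa [hm] using h1

theorem beta_left_le {c : V} (hca : c ≠ a) (hcb : c ≠ b) (hc : T.parent c = a)
    (hw : w ≤ T.beta c) : (T.exchange a b x w h).beta a ≤ T.beta c := by
  obtain ⟨m, hm, _, _, _, h1, -⟩ := h.exists_beta
  simpa [hm] using h1 c hca hcb hc hw

theorem proper_left : (T.exchange a b x w h).ProperEdge a :=
  ⟨h.left_ne_root, by rw [h.parent_left]; exact h.lt_beta_left⟩

theorem properEdge_right_iff : (T.exchange a b x w h).ProperEdge b ↔ T.ProperEdge a := by
  unfold ProperEdge
  rw [h.right_ne_root_iff, h.beta_right, h.parent_right]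
  refine and_congr_right fun ha => ?_
  rw [if_neg ha]

/-- An edge that moves from `a` to `b` is improper before and after: its `β` is below `w`, while `w
≤ a` and `w ≤ β(b) ≤ b`. -/
theorem properEdge_iff_of_ne {z : V} (hza : z ≠ a) (hzb : z ≠ b) :
    (T.exchange a b x w h).ProperEdge z ↔ T.ProperEdge z := by
  unfold ProperEdge
  rw [h.ne_root_iff hza hzb, h.beta_of_ne hza hzb]
  refine and_congr_right fun _ => ?_
  by_cases hR : T.parent z = a ∧ T.beta z < w
  · rw [h.parent_of_lt hza hR.1 hR.2, hR.1]
    exact iff_of_false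
      (not_lt.2 (hR.2.le.trans (h.le_beta.trans (T.beta_le_self b))))
      (not_lt.2 (hR.2.le.trans h.le))
  · rw [h.parent_of_not hza hzb hR]

/-- The new edge above `b` inherits the father and the `β` of the old edge above `a`; the new edge
above `a` and the old one above `b` are both proper. -/
theorem improperEdge_iff (z : V) :
    (T.exchange a b x w h).ImproperEdge z ↔ T.ImproperEdge (Equiv.swap a b z) := by
  have key : ∀ (S : LabelledTree V) z, S.ImproperEdge z ↔ z ≠ S.root ∧ ¬ S.ProperEdge z :=
    fun S z => by unfold ImproperEdge ProperEdge; tauto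
  rw [key, key]
  by_cases hza : z = a
  · subst hza
    rw [Equiv.swap_apply_left]
    have := h.proper_left
    have := h.proper
    tauto
  by_cases hzb : z = b
  · subst hzb
    rw [Equiv.swap_apply_right, h.right_ne_root_iff, h.properEdge_right_iff]
  · rw [Equiv.swap_apply_of_ne_of_ne hza hzb, h.properEdge_iff_of_ne hza hzb,
      h.ne_root_iff hza hzb]

theorem improperCount_eq : (T.exchange a b x w h).improperCount = T.improperCount := by
  unfold improperCount
  rw [← Set.ncard_image_of_injective {y | T.ImproperEdge y} (Equiv.swap a b).injective]
  congr 1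
  ext z
  simp only [Set.mem_ofPred_eq, h.improperEdge_iff]
  constructor
  · exact fun hz => ⟨_, hz, Equiv.swap_apply_self a b z⟩
  · rintro ⟨y, hy, rfl⟩
    rwa [Equiv.swap_apply_self]

theorem desc_right_iff {z : V} :
    (T.exchange a b x w h).Desc b z ↔ z = b ∨ (z ≠ a ∧ T.Desc a z) := by
  rw [desc_iff_eq_or_parent, h.parent_right, eq_comm]
  by_cases ha : a = T.root
  · rw [if_pos ha]
    have : b = (T.exchange a b x w h).root := by rw [root_eq, if_pos ha]
    constructor
    · rintro (rfl | hd)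
      · exact Or.inl rfl
      · have hd' : (T.exchange a b x w h).Desc (T.exchange a b x w h).root z :=
          this.subst (motive := fun u => (T.exchange a b x w h).Desc u z) hd
        exact Or.inl ((eq_root_of_desc hd').trans this.symm)
    · rintro (rfl | ⟨h1, h2⟩)
      · exact Or.inl rfl
      · rw [ha] at h2
        exact absurd ((eq_root_of_desc h2).trans ha.symm) h1
  · have hn := h.not_desc_parent_left ha
    rw [if_neg ha, desc_iff_of_agree_root (T := T)]
    · refine or_congr Iff.rfl ⟨fun hd => ⟨?_, (T.desc_parent a).trans hd⟩,
        fun hd => hd.2.parent hd.1.symm⟩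
      rintro rfl
      exact hn.1 hd
    · intro y hy
      refine h.parent_of_ne ?_ ?_ ?_
      · rintro rfl
        exact hn.1 hy
      · rintro rfl
        exact hn.2 hy
      · rintro he
        exact hn.1 (he ▸ hy.trans (T.desc_parent y))

theorem not_desc_right_left : ¬ (T.exchange a b x w h).Desc b a := by
  rw [h.desc_right_iff]
  rintro (he | he)
  · exact h.ne he
  · exact he.1 rfl

theorem desc_iff_of_desc_right {v z : V} (hv : T.Desc v b) :
    (T.exchange a b x w h).Desc v z ↔
      (T.Desc v z ∧ T.Desc z b) ∨ z = b ∨ (z ≠ a ∧ T.Desc a z) := by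
  rw [← h.desc_right_iff]
  refine desc_iff_of_agree hv fun y _ hy hyb => h.parent_of_ne ?_ hyb ?_
  · rintro rfl
    exact h.not_desc hy
  · intro he
    exact h.not_desc (he ▸ hy.parent hyb)

/-- Exchanging back restores the tree. -/
theorem exchange_exchange
    (h' : (T.exchange a b x w h).Exchangeable b a (T.parent b) w) :
    (T.exchange a b x w h).exchange b a (T.parent b) w h' = T := by
  have hroot : b = (T.exchange a b x w h).root ↔ a = T.root := by
    simpa using not_congr h.right_ne_root_iff
  ext z
  · rw [h'.root_eq]
    split_ifs with hb
    · exact hroot.1 hb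
    · rw [h.root_eq, if_neg (fun ha => hb (hroot.2 ha))]
  · by_cases hzb : z = b
    · rw [hzb, h'.parent_left]
    by_cases hza : z = a
    · rw [hza, h'.parent_right]
      by_cases ha : a = T.root
      · rw [if_pos (hroot.2 ha)]
        nth_rw 2 [ha]
        rw [T.parent_root, ha]
      · rw [if_neg (fun hh => ha (hroot.1 hh)), h.parent_right, if_neg ha]
    by_cases hR : T.parent z = a ∧ T.beta z < w
    · rw [h'.parent_of_lt hzb (h.parent_of_lt hza hR.1 hR.2)
        (by rw [h.beta_of_ne hza hzb]; exact hR.2), hR.1]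
    · rw [h'.parent_of_not hzb hza, h.parent_of_not hza hzb hR]
      rw [h.parent_of_not hza hzb hR, h.beta_of_ne hza hzb]
      -- Original children of `b` have `β ≥ β(b) ≥ w`, so only the edges that came from `a` move
      -- back.
      rintro ⟨h1, h2⟩
      exact absurd (h1 ▸ T.beta_parent_le z) (not_le.2 (h2.trans_le h.le_beta))

end Exchangeable

end Exchange
end LabelledTree

namespace LabelledTree

/-! ### Detaching the last proper edge and attaching it again -/

section Detach

variable {V : Type*} [LinearOrder V] [Fintype V] [BoundedOrder V]

/-- The edge with father `w` and child `y` is the last proper edge on the path from `⊤` to the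
root, and `q` is the first node on the path from `w` to the root with `β(q) < w`. -/
structure Detachable (T : LabelledTree V) (w y q : V) : Prop where
  not_desc_bot : ¬ T.Desc ⊤ ⊥
  desc_top : T.Desc ⊤ y
  parent_eq : T.parent y = w
  proper : T.ProperEdge y
  last : ∀ z, T.Desc ⊤ z → T.ProperEdge z → T.Desc z y
  desc : T.Desc w q
  beta_lt : T.beta q < w
  first : ∀ z, T.Desc w z → T.beta z < w → T.Desc q z
  child_lt : ∀ c, c ≠ T.root → T.parent c = ⊥ → T.beta c < w

/-- The node `q` is the child of `⊥` with the largest value `w = β(q)`, and `y` is the first node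
on the path from `⊤` to the root with `β(y) < w`. -/
structure Attachable (T : LabelledTree V) (w y q : V) : Prop where
  not_desc_bot : ¬ T.Desc ⊤ ⊥
  ne_root : q ≠ T.root
  parent_eq : T.parent q = ⊥
  beta_eq : T.beta q = w
  child_le : ∀ c, c ≠ T.root → T.parent c = ⊥ → T.beta c ≤ w
  desc_top : T.Desc ⊤ y
  beta_lt : T.beta y < w
  first : ∀ z, T.Desc ⊤ z → T.beta z < w → T.Desc y z
  lt_parent : ∀ z, T.Desc ⊤ z → T.ProperEdge z → w < T.parent z

variable {T : LabelledTree V} {w y q : V}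

/-- If `⊥` lies below `a`, the child of `a` above it has `β = ⊥ < w` and moves away, so `⊥` may
become the father of `a`. -/
theorem reach_bot {a b : V} (hlt : T.beta a < w) (hle : w ≤ a) :
    ¬ T.Desc ⊥ a ∨ (∃ c, c ≠ a ∧ T.parent c = a ∧ T.beta c < w ∧ T.Desc ⊥ c) ∨ T.Desc ⊥ b := by
  by_cases hd : T.Desc ⊥ a
  · have hbw : ⊥ < w := bot_le.trans_lt hlt
    obtain ⟨c, h1, h2, h3⟩ := exists_child_of_desc hd (hbw.trans_le hle).ne
    exact Or.inr (Or.inl ⟨c, fun he => parent_ne h1 (h2.trans he.symm), h2,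
      by rwa [beta_eq_bot h3], h3⟩)
  · exact Or.inl hd

namespace Detachable

variable (h : T.Detachable w y q)
include h

theorem bot_lt : ⊥ < w := bot_le.trans_lt h.beta_lt

theorem lt_beta : w < T.beta y := h.parent_eq ▸ h.proper.2

theorem lt : w < y := h.lt_beta.trans_le (T.beta_le_self y)

theorem not_desc_w : ¬ T.Desc w y := h.parent_eq ▸ not_desc_parent h.proper.1

theorem desc_y : T.Desc y q := (h.parent_eq ▸ T.desc_parent y : T.Desc y w).trans h.desc

/-- If `w ≠ q`, let `c` be the child of `q` towards `w`. Its edge comes after the last proper edge,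
so it is improper and `β(c) ≤ q`; the choice of `q` gives `w ≤ β(c)`. -/
theorem le : w ≤ q := by
  by_cases he : w = q
  · exact he.le
  obtain ⟨c, h1, h2, h3⟩ := exists_child_of_desc h.desc he
  have hyw : T.Desc y w := h.parent_eq ▸ T.desc_parent y
  have hn : ¬ T.ProperEdge c := fun hp =>
    h.not_desc_w (h3.trans (h.last c (h.desc_top.trans (hyw.trans h3)) hp))
  have hc : T.beta c ≤ q := by
    rw [← h2]
    exact not_lt.1 fun hh => hn ⟨h1, hh⟩
  refine (not_lt.1 fun hh => ?_).trans hc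
  exact not_desc_parent h1 (h2.symm ▸ h.first c h3 hh)

theorem exchangeable : T.Exchangeable q y ⊥ w where
  not_desc hd := h.not_desc_w (h.desc.trans hd)
  proper := h.proper
  beta_lt := h.beta_lt
  le := h.le
  le_beta := h.lt_beta.le
  reach := reach_bot h.beta_lt h.le
  lt := h.bot_lt.trans_le h.le
  lt_beta _ _ _ _ hc := h.bot_lt.trans_le hc

/-- The node `w` stays below `q`: the child of `q` towards it, if any, has `β ≥ w` by the choice of
`q`. Thus the new child of `⊥` records `w`. -/
theorem beta_left : (T.exchange q y ⊥ w h.exchangeable).beta q = w := by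
  have hE := h.exchangeable
  refine le_antisymm ?_ hE.le_beta_left
  by_cases he : w = q
  · exact (beta_le_self _ q).trans he.ge
  obtain ⟨c, h1, h2, h3⟩ := exists_child_of_desc h.desc he
  have hcy : c ≠ y := fun hh => h.not_desc_w (hh ▸ h3)
  have hcq : c ≠ q := fun hh => parent_ne h1 (h2.trans hh.symm)
  have hw : w ≤ T.beta c := not_lt.1 fun hh =>
    not_desc_parent h1 (h2.symm ▸ h.first c h3 hh)
  exact (hE.beta_left_le hcq hcy h2 hw).trans (T.beta_le h3)

theorem exchangeable_symm :
    (T.exchange q y ⊥ w h.exchangeable).Exchangeable y q w w where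
  not_desc := h.exchangeable.not_desc_right_left
  proper := h.exchangeable.proper_left
  beta_lt := h.exchangeable.beta_right.symm ▸ h.beta_lt
  le := h.lt.le
  le_beta := h.exchangeable.le_beta_left
  reach := Or.inr (Or.inr (by
    have := (T.exchange q y ⊥ w h.exchangeable).beta_desc q
    rwa [h.beta_left] at this))
  lt := h.lt
  lt_beta c hcy hcq hc hw := by
    have hE := h.exchangeable
    rw [hE.beta_of_ne hcq hcy] at hw ⊢
    rw [hE.parent_of_le hcq hcy hw] at hc
    exact h.lt_beta.trans_le (hc ▸ T.beta_parent_le c)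

theorem desc_top_iff {z : V} : (T.exchange q y ⊥ w h.exchangeable).Desc ⊤ z ↔
    (T.Desc ⊤ z ∧ T.Desc z y) ∨ z = y ∨ (z ≠ q ∧ T.Desc q z) :=
  h.exchangeable.desc_iff_of_desc_right h.desc_top

theorem not_proper_q : ¬ T.ProperEdge q := fun hp =>
  h.exchangeable.not_desc (h.last q (h.desc_top.trans h.desc_y) hp)

/-- The new path runs from `⊤` to `y` and then along the old path above `q`. The skipped nodes from
`w` to `q` carry no proper edge, and the edge above `y` is now of the type of the old one above `q`.
-/
theorem desc_proper_iff {z : V} :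
    ((T.exchange q y ⊥ w h.exchangeable).Desc ⊤ z ∧
      (T.exchange q y ⊥ w h.exchangeable).ProperEdge z) ↔
    (T.Desc ⊤ z ∧ T.ProperEdge z) ∧ z ≠ y := by
  have hE := h.exchangeable
  rw [h.desc_top_iff]
  by_cases hzy : z = y
  · subst hzy
    refine iff_of_false (fun hh => h.not_proper_q (hE.properEdge_right_iff.1 hh.2))
      (fun hh => hh.2 rfl)
  by_cases hzq : z = q
  · subst hzq
    refine iff_of_false (fun hh => ?_) (fun hh => h.not_proper_q hh.1.2)
    rcases hh.1 with hh | hh | hh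
    · exact hE.not_desc hh.2
    · exact hzy hh
    · exact hh.1 rfl
  rw [hE.properEdge_iff_of_ne hzq hzy]
  constructor
  · rintro ⟨hd | hd | hd, hp⟩
    · exact ⟨⟨hd.1, hp⟩, hzy⟩
    · exact absurd hd hzy
    · have h1 := h.last z (h.desc_top.trans (h.desc_y.trans hd.2)) hp
      exact absurd ((h.desc_y.trans hd.2).antisymm h1).symm hzy
  · rintro ⟨⟨hd, hp⟩, _⟩
    exact ⟨Or.inl ⟨hd, h.last z hd hp⟩, hp⟩

theorem attachable : (T.exchange q y ⊥ w h.exchangeable).Attachable w y q where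
  not_desc_bot hd := by
    rcases h.desc_top_iff.1 hd with hd | hd | hd
    · exact h.not_desc_bot hd.1
    · exact absurd (hd ▸ h.lt) not_lt_bot
    · exact h.not_desc_bot (h.desc_top.trans (h.desc_y.trans hd.2))
  ne_root := h.exchangeable.left_ne_root
  parent_eq := h.exchangeable.parent_left
  beta_eq := h.beta_left
  child_le c hc hcb := by
    have hE := h.exchangeable
    by_cases hcq : c = q
    · subst hcq
      exact h.beta_left.le
    by_cases hcy : c = y
    · subst hcy
      rw [hE.parent_right, if_neg (hE.right_ne_root_iff.1 hc)] at hcb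
      exact absurd (hcb ▸ h.desc_top.trans (h.desc_y.trans (T.desc_parent q))) h.not_desc_bot
    by_cases hR : T.parent c = q ∧ T.beta c < w
    · rw [hE.parent_of_lt hcq hR.1 hR.2] at hcb
      exact absurd (hcb ▸ h.lt) not_lt_bot
    · rw [hE.parent_of_not hcq hcy hR] at hcb
      rw [hE.beta_of_ne hcq hcy]
      exact (h.child_lt c ((hE.ne_root_iff hcq hcy).1 hc) hcb).le
  desc_top := h.desc_top_iff.2 (Or.inr (Or.inl rfl))
  beta_lt := h.exchangeable.beta_right.symm ▸ h.beta_lt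
  first z hz hzw := by
    have hE := h.exchangeable
    rw [hE.desc_right_iff]
    rcases h.desc_top_iff.1 hz with hd | hd
    · by_cases hzy : z = y
      · exact Or.inl hzy
      have hzq : z ≠ q := by
        rintro rfl
        exact hE.not_desc hd.2
      rw [hE.beta_of_ne hzq hzy] at hzw
      exact absurd (h.lt_beta.trans_le (beta_anti hd.2)) hzw.asymm
    · exact hd
  -- The remaining proper edges have their fathers in `T_y`, hence above `w`.
  lt_parent z hz hp := by
    have hE := h.exchangeable
    obtain ⟨⟨h1, h2⟩, h3⟩ := h.desc_proper_iff.1 ⟨hz, hp⟩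
    have h4 := h.last z h1 h2
    have h5 := h4.parent h3
    have hzq : z ≠ q := by
      rintro rfl
      exact hE.not_desc h4
    rw [hE.parent_of_ne hzq h3 (fun he => hE.not_desc (he ▸ h5))]
    exact h.lt_beta.trans_le (T.beta_le h5)

theorem exchange_exchange :
    (T.exchange q y ⊥ w h.exchangeable).exchange y q w w h.exchangeable_symm = T := by
  have := h.exchangeable.exchange_exchange (h.parent_eq.symm ▸ h.exchangeable_symm)
  simpa only [h.parent_eq] using this

theorem properOnPath_eq :
    T.properOnPath ⊤ = (T.exchange q y ⊥ w h.exchangeable).properOnPath ⊤ + 1 := by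
  unfold properOnPath
  simp only [h.desc_proper_iff]
  rw [← Set.ncard_insert_of_notMem (a := y) (by simp) (Set.toFinite _)]
  congr 1
  ext z
  by_cases hz : z = y
  · subst hz
    simp [h.desc_top, h.proper]
  · simp [hz]

theorem deg_bot_eq : (T.exchange q y ⊥ w h.exchangeable).deg ⊥ = T.deg ⊥ + 1 := by
  have hE := h.exchangeable
  have hpq : T.parent q ≠ ⊥ := fun he =>
    h.not_desc_bot (he ▸ h.desc_top.trans (h.desc_y.trans (T.desc_parent q)))
  unfold deg
  rw [← Set.ncard_insert_of_notMem (a := q) (fun hh => hpq hh.2) (Set.toFinite _)]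
  congr 1
  ext z
  simp only [Set.mem_insert_iff, Set.mem_ofPred_eq]
  by_cases hzq : z = q
  · subst hzq
    exact iff_of_true ⟨hE.left_ne_root, hE.parent_left⟩ (Or.inl rfl)
  by_cases hzy : z = y
  · subst hzy
    refine iff_of_false (fun hh => ?_) ?_
    · have hq := hE.right_ne_root_iff.1 hh.1
      rw [hE.parent_right, if_neg hq] at hh
      exact hpq hh.2
    · rintro (hh | hh)
      · exact hzq hh
      · exact h.bot_lt.ne' (h.parent_eq.symm.trans hh.2)
  rw [hE.ne_root_iff hzq hzy]
  by_cases hR : T.parent z = q ∧ T.beta z < w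
  · rw [hE.parent_of_lt hzq hR.1 hR.2]
    refine iff_of_false (fun hh => absurd (hh.2 ▸ h.lt) not_lt_bot) ?_
    rintro (hh | hh)
    · exact hzq hh
    · exact absurd (hR.1.symm.trans hh.2) (h.bot_lt.trans_le h.le).ne'
  · rw [hE.parent_of_not hzq hzy hR]
    simp [hzq]

end Detachable

namespace Attachable

variable (h : T.Attachable w y q)
include h

theorem bot_lt : ⊥ < w := bot_le.trans_lt h.beta_lt

theorem not_desc_y_bot : ¬ T.Desc y ⊥ := fun hd => h.not_desc_bot (h.desc_top.trans hd)

theorem desc_q_bot : T.Desc q ⊥ := h.parent_eq ▸ T.desc_parent q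

theorem not_desc : ¬ T.Desc y q := fun hd => h.not_desc_y_bot (hd.trans h.desc_q_bot)

theorem desc_w : T.Desc w q := h.beta_eq ▸ T.beta_desc q

/-- If `y ≠ ⊤`, the child of `y` towards `⊤` has `β ≥ w`. With `y < w` its edge would be proper with
father below `w`, against `lt_parent`. -/
theorem lt : w < y := by
  refine lt_of_le_of_ne ?_ (fun he => h.not_desc (he ▸ h.desc_w))
  by_cases he : ⊤ = y
  · exact he ▸ le_top
  obtain ⟨c, h1, h2, h3⟩ := exists_child_of_desc h.desc_top he
  have hc : w ≤ T.beta c := not_lt.1 fun hh => not_desc_parent h1 (h2.symm ▸ h.first c h3 hh)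
  refine not_lt.1 fun hh => ?_
  exact absurd (h2 ▸ h.lt_parent c h3 ⟨h1, h2.symm ▸ hh.trans_le hc⟩) hh.asymm

theorem proper : T.ProperEdge q :=
  ⟨h.ne_root, by rw [h.parent_eq, h.beta_eq]; exact h.bot_lt⟩

/-- `q` is the only child of its father whose subtree contains `w`. -/
theorem eq_of_beta_eq {c : V} (hc : T.beta c = w)
    (hpq : ¬ T.Desc (T.parent c) q) : c = q := by
  by_contra hne
  have hd : T.Desc w c := hc ▸ T.beta_desc c
  rcases hd.total h.desc_w with hh | hh
  · exact hpq (hh.parent hne)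
  · have := hh.parent (Ne.symm hne)
    rw [h.parent_eq] at this
    exact h.bot_lt.ne' (hc.symm.trans (beta_eq_bot this))

theorem exchangeable : T.Exchangeable y q w w where
  not_desc := h.not_desc
  proper := h.proper
  beta_lt := h.beta_lt
  le := h.lt.le
  le_beta := h.beta_eq.ge
  reach := Or.inr (Or.inr h.desc_w)
  lt := h.lt
  lt_beta _ _ hcq hc hw := lt_of_le_of_ne hw fun he => hcq
    (h.eq_of_beta_eq he.symm (hc.symm ▸ h.not_desc))

theorem exchangeable_symm :
    (T.exchange y q w w h.exchangeable).Exchangeable q y ⊥ w where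
  not_desc := h.exchangeable.not_desc_right_left
  proper := h.exchangeable.proper_left
  beta_lt := h.exchangeable.beta_right.symm ▸ h.beta_lt
  le := h.beta_eq ▸ T.beta_le_self q
  le_beta := h.exchangeable.le_beta_left
  reach := reach_bot (h.exchangeable.beta_right.symm ▸ h.beta_lt)
    (h.beta_eq ▸ T.beta_le_self q)
  lt := h.bot_lt.trans_le (h.beta_eq ▸ T.beta_le_self q)
  lt_beta _ _ _ _ hc := h.bot_lt.trans_le hc

theorem exchange_exchange :
    (T.exchange y q w w h.exchangeable).exchange q y ⊥ w h.exchangeable_symm = T := by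
  have := h.exchangeable.exchange_exchange (h.parent_eq.symm ▸ h.exchangeable_symm)
  simpa only [h.parent_eq] using this

theorem desc_w_iff {z : V} : (T.exchange y q w w h.exchangeable).Desc w z ↔
    (T.Desc w z ∧ T.Desc z q) ∨ z = q ∨ (z ≠ y ∧ T.Desc y z) :=
  h.exchangeable.desc_iff_of_desc_right h.desc_w

theorem desc_y_iff {z : V} : (T.exchange y q w w h.exchangeable).Desc y z ↔
    z = y ∨ (T.exchange y q w w h.exchangeable).Desc w z := by
  rw [desc_iff_eq_or_parent, h.exchangeable.parent_left, eq_comm]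

/-- Before `y`, the nodes on the path from `⊤` have `β ≥ w`, so their edges stay. -/
theorem desc_top_iff {z : V} : (T.exchange y q w w h.exchangeable).Desc ⊤ z ↔
    (T.Desc ⊤ z ∧ T.Desc z y) ∨ (T.exchange y q w w h.exchangeable).Desc y z := by
  refine desc_iff_of_agree h.desc_top fun x hx hxy hne => ?_
  refine h.exchangeable.parent_of_le hne ?_ ?_
  · rintro rfl
    exact h.not_desc_bot (hx.trans h.desc_q_bot)
  · exact not_lt.1 fun hh => hne (hxy.antisymm (h.first x hx hh))

theorem desc_top' : (T.exchange y q w w h.exchangeable).Desc ⊤ y :=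
  h.desc_top_iff.2 (Or.inr (desc_refl _ y))

theorem detachable : (T.exchange y q w w h.exchangeable).Detachable w y q where
  not_desc_bot hd := by
    rcases h.desc_top_iff.1 hd with hd | hd
    · exact h.not_desc_bot hd.1
    rcases h.desc_y_iff.1 hd with hd | hd
    · exact absurd (hd ▸ h.lt) not_lt_bot
    rcases h.desc_w_iff.1 hd with hd | hd | hd
    · exact h.bot_lt.ne' (h.beta_eq.symm.trans (beta_eq_bot hd.2))
    · exact h.proper.1 (by
        by_contra hr
        exact parent_ne hr (h.parent_eq.trans hd))
    · exact h.not_desc_y_bot hd.2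
  desc_top := h.desc_top'
  parent_eq := h.exchangeable.parent_left
  proper := h.exchangeable.proper_left
  last z hz hp := by
    have hE := h.exchangeable
    rcases hz.total h.desc_top' with hd | hd
    · exact hd
    rcases h.desc_y_iff.1 hd with rfl | hd
    · exact desc_refl _ _
    -- Beyond `y` the edges of the new path have `β ≤ w` and, if proper, a father that is at least
    -- `w`: a contradiction in each case.
    exfalso
    by_cases hzq : z = q
    · subst hzq
      have h1 := hE.properEdge_right_iff.1 hp
      have h2 := h.lt_parent y h.desc_top h1
      exact absurd (h2.trans h1.2) h.beta_lt.asymm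
    rcases h.desc_w_iff.1 hd with hd | hd | hd
    · have hzy : z ≠ y := fun he => h.not_desc (he ▸ hd.2)
      have h1 := ((hE.properEdge_iff_of_ne hzy hzq).1 hp).2
      have h2 : w ≤ T.parent z := h.beta_eq ▸ T.beta_le (hd.2.parent hzq)
      exact absurd (h2.trans_lt h1) (not_lt.2 (T.beta_le hd.1))
    · exact hzq hd
    · have h1 := (hE.properEdge_iff_of_ne hd.1 hzq).1 hp
      have h2 := h.lt_parent z (h.desc_top.trans hd.2) h1
      exact absurd (h2.trans h1.2) (not_lt.2 ((beta_anti hd.2).trans h.beta_lt.le))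
  desc := h.desc_w_iff.2 (Or.inr (Or.inl rfl))
  beta_lt := h.exchangeable.beta_right.symm ▸ h.beta_lt
  first z hz hzw := by
    have hE := h.exchangeable
    rw [hE.desc_right_iff]
    rcases h.desc_w_iff.1 hz with hd | hd
    · by_cases hzq : z = q
      · exact Or.inl hzq
      have hzy : z ≠ y := by
        rintro rfl
        exact h.not_desc hd.2
      rw [hE.beta_of_ne hzy hzq] at hzw
      exact absurd (h.beta_eq ▸ beta_anti hd.2) (not_le.2 hzw)
    · exact hd
  child_lt c hc hcb := by
    have hE := h.exchangeable
    by_cases hcq : c = q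
    · subst hcq
      rw [hE.parent_right, if_neg (hE.right_ne_root_iff.1 hc)] at hcb
      exact absurd (hcb ▸ T.desc_parent y) h.not_desc_y_bot
    by_cases hcy : c = y
    · subst hcy
      rw [hE.parent_left] at hcb
      exact absurd hcb h.bot_lt.ne'
    by_cases hR : T.parent c = y ∧ T.beta c < w
    · rw [hE.parent_of_lt hcy hR.1 hR.2] at hcb
      rw [hE.beta_of_ne hcy hcq]
      exact hR.2
    · rw [hE.parent_of_not hcy hcq hR] at hcb
      rw [hE.beta_of_ne hcy hcq]
      -- Equality is excluded since only `q` attains `w`, and `q` is no longer a child of `⊥`.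
      refine lt_of_le_of_ne (h.child_le c ((hE.ne_root_iff hcy hcq).1 hc) hcb) fun he => hcq ?_
      refine h.eq_of_beta_eq he fun hh => ?_
      rw [hcb] at hh
      exact h.bot_lt.ne' (h.beta_eq.symm.trans (beta_eq_bot hh))

end Attachable

/-! ### Trading proper edges on the path for children of `⊥` -/

open Classical in
/-- Two sets related by a relation that is a bijection between them are equinumerous. -/
theorem nonempty_equiv_of_rel {α β : Type*} {A : Set α} {B : Set β} (R : α → β → Prop)
    (h1 : ∀ a ∈ A, ∃ b ∈ B, R a b) (h2 : ∀ b ∈ B, ∃ a ∈ A, R a b)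
    (h3 : ∀ a b b', R a b → R a b' → b = b') (h4 : ∀ a a' b, R a b → R a' b → a = a') :
    Nonempty (A ≃ B) := by
  choose f hf hR using h1
  refine ⟨Equiv.ofBijective (fun a => ⟨f a.1 a.2, hf a.1 a.2⟩) ⟨fun a a' he => ?_, fun b => ?_⟩⟩
  · have he' : f a.1 a.2 = f a'.1 a'.2 := congrArg Subtype.val he
    exact Subtype.ext (h4 _ _ _ (hR a.1 a.2) (he' ▸ hR a'.1 a'.2))
  · obtain ⟨a, ha, hab⟩ := h2 b.1 b.2
    exact ⟨⟨a, ha⟩, Subtype.ext (h3 _ _ _ (hR a ha) hab)⟩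

theorem Detachable.unique {w' y' q' : V} (h : T.Detachable w y q) (h' : T.Detachable w' y' q') :
    w = w' ∧ y = y' ∧ q = q' := by
  have hy : y = y' := (h'.last y h.desc_top h.proper).antisymm (h.last y' h'.desc_top h'.proper)
  have hw : w = w' := by rw [← h.parent_eq, ← h'.parent_eq, hy]
  subst hw
  exact ⟨rfl, hy, (h.first q' h'.desc h'.beta_lt).antisymm (h'.first q h.desc h.beta_lt)⟩

theorem Attachable.unique {w' y' q' : V} (h : T.Attachable w y q) (h' : T.Attachable w' y' q') :
    w = w' ∧ y = y' ∧ q = q' := by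
  have hw : w = w' := le_antisymm (h.beta_eq ▸ h'.child_le q h.ne_root h.parent_eq)
    (h'.beta_eq ▸ h.child_le q' h'.ne_root h'.parent_eq)
  subst hw
  exact ⟨rfl, (h.first y' h'.desc_top h'.beta_lt).antisymm (h'.first y h.desc_top h.beta_lt),
    child_unique h.ne_root h.parent_eq h.desc_w h'.ne_root h'.parent_eq h'.desc_w⟩

/-- The trees with `k` improper edges, `i` proper edges on the path from `⊤` to the root and
`j` children of `⊥`, where `⊥` is not on this path and the values `β(c)` of the children `c` of
`⊥` are smaller than the father nodes of these proper edges. -/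
def separatedTrees (V : Type*) [LinearOrder V] [Fintype V] [BoundedOrder V] (k i j : ℕ) :
    Set (LabelledTree V) :=
  {T | T.improperCount = k ∧ T.properOnPath ⊤ = i ∧ T.deg ⊥ = j ∧ ¬ T.Desc ⊤ ⊥ ∧
    ∀ c, c ≠ T.root → T.parent c = ⊥ → ∀ z, T.Desc ⊤ z → T.ProperEdge z → T.beta c < T.parent z}

theorem beta_root_eq_bot (T : LabelledTree V) : T.beta T.root = ⊥ := beta_eq_bot (T.desc_root ⊥)

theorem exists_detachable {k i j : ℕ} (hT : T ∈ separatedTrees V k (i + 1) j) :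
    ∃ w y q, T.Detachable w y q := by
  obtain ⟨-, h2, -, h4, h5⟩ := hT
  have h6 : T.properOnPath ⊤ ≠ 0 := by omega
  obtain ⟨y, ⟨hy1, hy2⟩, hy3⟩ := exists_last_ancestor (T := T) (v := ⊤) (P := T.ProperEdge)
    (Set.nonempty_of_ncard_ne_zero h6)
  have hb : ⊥ < T.parent y := bot_lt_iff_ne_bot.2 fun he =>
    h4 (he ▸ hy1.trans (T.desc_parent y))
  obtain ⟨q, ⟨hq1, hq2⟩, hq3⟩ := exists_first_ancestor (T := T) (v := T.parent y)
    (P := fun z => T.beta z < T.parent y) ⟨T.root, T.desc_root _, by rwa [beta_root_eq_bot]⟩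
  exact ⟨_, y, q, h4, hy1, rfl, hy2, fun z h h' => hy3 z ⟨h, h'⟩, hq1, hq2,
    fun z h h' => hq3 z ⟨h, h'⟩, fun c h h' => h5 c h h' y hy1 hy2⟩

theorem exists_attachable {k i j : ℕ} (hT : T ∈ separatedTrees V k i (j + 1)) :
    ∃ w y q, T.Attachable w y q := by
  obtain ⟨-, -, h3, h4, h5⟩ := hT
  have h6 : T.deg ⊥ ≠ 0 := by omega
  obtain ⟨q, ⟨hq1, hq2⟩, hq3⟩ := Set.exists_max_image {y | y ≠ T.root ∧ T.parent y = ⊥} T.beta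
    (Set.toFinite _) (Set.nonempty_of_ncard_ne_zero h6)
  have hb : ⊥ < T.beta q := bot_lt_iff_ne_bot.2 fun he =>
    not_desc_parent hq1 (by rw [hq2]; exact he ▸ T.beta_desc q)
  obtain ⟨y, ⟨hy1, hy2⟩, hy3⟩ := exists_first_ancestor (T := T) (v := ⊤)
    (P := fun z => T.beta z < T.beta q) ⟨T.root, T.desc_root _, by rwa [beta_root_eq_bot]⟩
  exact ⟨_, y, q, h4, hq1, hq2, rfl, fun c h h' => hq3 c ⟨h, h'⟩, hy1, hy2,
    fun z h h' => hy3 z ⟨h, h'⟩, fun z h h' => h5 q hq1 hq2 z h h'⟩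

/-- Fathers of proper edges on the path decrease towards the root, so the last one is the smallest.
-/
theorem Detachable.le_parent (h : T.Detachable w y q) {z : V} (hz : T.Desc ⊤ z)
    (hp : T.ProperEdge z) : w ≤ T.parent z := by
  have hd := h.last z hz hp
  by_cases he : z = y
  · rw [he, h.parent_eq]
  · exact h.lt_beta.le.trans (T.beta_le (hd.parent he))

theorem nonempty_equiv_separatedTrees_succ (k i j : ℕ) :
    Nonempty (separatedTrees V k (i + 1) j ≃ separatedTrees V k i (j + 1)) := by
  -- The relation records the exchange in both directions, so uniqueness of the data `w`, `y`, `q`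
  -- on either side makes it one-to-one.
  refine nonempty_equiv_of_rel (fun T T' => ∃ w y q, ∃ (h : T.Detachable w y q)
    (h' : T'.Attachable w y q), T' = T.exchange q y ⊥ w h.exchangeable ∧
      T = T'.exchange y q w w h'.exchangeable) ?_ ?_ ?_ ?_
  · intro T hT
    obtain ⟨w, y, q, h⟩ := exists_detachable hT
    refine ⟨_, ⟨?_, ?_, ?_, h.attachable.not_desc_bot, fun c hc hcb z hz hp => ?_⟩,
      w, y, q, h, h.attachable, rfl, h.exchange_exchange.symm⟩
    · rw [h.exchangeable.improperCount_eq, hT.1]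
    · have := h.properOnPath_eq
      rw [hT.2.1] at this
      omega
    · rw [h.deg_bot_eq, hT.2.2.1]
    · exact (h.attachable.child_le c hc hcb).trans_lt (h.attachable.lt_parent z hz hp)
  · intro T hT
    obtain ⟨w, y, q, h⟩ := exists_attachable hT
    refine ⟨_, ⟨?_, ?_, ?_, h.detachable.not_desc_bot, fun c hc hcb z hz hp => ?_⟩,
      w, y, q, h.detachable, h, h.exchange_exchange.symm, rfl⟩
    · rw [h.exchangeable.improperCount_eq, hT.1]
    · rw [h.detachable.properOnPath_eq, h.exchange_exchange, hT.2.1]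
    · have := h.detachable.deg_bot_eq
      rw [h.exchange_exchange, hT.2.2.1] at this
      omega
    · exact (h.detachable.child_lt c hc hcb).trans_le (h.detachable.le_parent hz hp)
  · rintro T T₁ T₂ ⟨w, y, q, h, _, rfl, -⟩ ⟨w', y', q', h', _, rfl, -⟩
    obtain ⟨rfl, rfl, rfl⟩ := h.unique h'
    rfl
  · rintro T₁ T₂ T ⟨w, y, q, _, h, -, rfl⟩ ⟨w', y', q', _, h', -, rfl⟩
    obtain ⟨rfl, rfl, rfl⟩ := h.unique h'
    rfl

theorem nonempty_equiv_separatedTrees (k i j m : ℕ) :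
    Nonempty (separatedTrees V k (i + m) j ≃ separatedTrees V k i (j + m)) := by
  induction m generalizing j with
  | zero => exact ⟨Equiv.refl _⟩
  | succ m ih =>
    obtain ⟨e⟩ := nonempty_equiv_separatedTrees_succ (V := V) k (i + m) j
    obtain ⟨e'⟩ := ih (j + 1)
    have h : j + (m + 1) = j + 1 + m := by omega
    rw [h]
    exact ⟨e.trans e'⟩

theorem not_desc_top_bot_of_deg_eq_zero (hd : T.deg ⊥ = 0) (hp : T.properOnPath ⊤ ≠ 0) :
    ¬ T.Desc ⊤ ⊥ := by
  intro h
  have h0 := (Set.ncard_eq_zero (Set.toFinite _)).1 hd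
  by_cases he : (⊤ : V) = ⊥
  · obtain ⟨y, -, hy, -⟩ := Set.nonempty_of_ncard_ne_zero hp
    have hall : ∀ v : V, v = ⊥ := fun v => le_bot_iff.1 (he ▸ le_top)
    exact hy ((hall y).trans (hall _).symm)
  · obtain ⟨c, h1, h2, -⟩ := exists_child_of_desc h he
    exact (h0 ▸ (⟨h1, h2⟩ : c ∈ {y | y ≠ T.root ∧ T.parent y = ⊥}) : c ∈ (∅ : Set V))

/-- Every edge with father `⊥` is proper, so a path from `⊤` through `⊥` would contain a proper
edge. -/
theorem not_desc_top_bot_of_properOnPath_eq_zero (hd : T.deg ⊥ ≠ 0)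
    (hp : T.properOnPath ⊤ = 0) : ¬ T.Desc ⊤ ⊥ := by
  intro h
  have h0 := (Set.ncard_eq_zero (Set.toFinite _)).1 hp
  by_cases he : (⊤ : V) = ⊥
  · obtain ⟨y, hy, -⟩ := Set.nonempty_of_ncard_ne_zero hd
    have hall : ∀ v : V, v = ⊥ := fun v => le_bot_iff.1 (he ▸ le_top)
    exact hy ((hall y).trans (hall _).symm)
  · obtain ⟨c, h1, h2, h3⟩ := exists_child_of_desc h he
    have hc : T.ProperEdge c := ⟨h1, by
      rw [h2, bot_lt_iff_ne_bot]
      exact fun hb => not_desc_parent h1 (by rw [h2]; exact hb ▸ T.beta_desc c)⟩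
    exact (h0 ▸ (⟨h3, hc⟩ : c ∈ {y | T.Desc ⊤ y ∧ T.ProperEdge y}) : c ∈ (∅ : Set V))

/-- At both ends of the chain the separation condition is vacuous: here `⊥` has no children, in the
next lemma the path has no proper edges. -/
theorem mem_separatedTrees_zero_right {k m : ℕ} (hm : m ≠ 0) :
    T ∈ separatedTrees V k m 0 ↔
      T.improperCount = k ∧ T.properOnPath ⊤ = m ∧ T.deg ⊥ = 0 := by
  refine ⟨fun h => ⟨h.1, h.2.1, h.2.2.1⟩, fun ⟨h1, h2, h3⟩ => ⟨h1, h2, h3,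
    not_desc_top_bot_of_deg_eq_zero h3 (h2 ▸ hm), fun c hc hcb => ?_⟩⟩
  have h0 := (Set.ncard_eq_zero (Set.toFinite _)).1 h3
  exact absurd (h0 ▸ (⟨hc, hcb⟩ : c ∈ {y | y ≠ T.root ∧ T.parent y = ⊥}) : c ∈ (∅ : Set V))
    (Set.notMem_empty c)

theorem mem_separatedTrees_zero_left {k m : ℕ} (hm : m ≠ 0) :
    T ∈ separatedTrees V k 0 m ↔
      T.improperCount = k ∧ T.properOnPath ⊤ = 0 ∧ T.deg ⊥ = m := by
  refine ⟨fun h => ⟨h.1, h.2.1, h.2.2.1⟩, fun ⟨h1, h2, h3⟩ => ⟨h1, h2, h3,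
    not_desc_top_bot_of_properOnPath_eq_zero (h3 ▸ hm) h2, fun c _ _ z hz hp => ?_⟩⟩
  have h0 := (Set.ncard_eq_zero (Set.toFinite _)).1 h2
  exact absurd (h0 ▸ (⟨hz, hp⟩ : z ∈ {y | T.Desc ⊤ y ∧ T.ProperEdge y}) : z ∈ (∅ : Set V))
    (Set.notMem_empty z)

end Detach
end LabelledTree

namespace LabelledTree

/-! ### Subtrees and degrees after rerooting -/

section Reroot

variable {V : Type*} {T : LabelledTree V} {a w : V} (haw : T.Desc a w)

theorem reroot_root_of_eq (hw : w = T.root) : (T.reroot a w haw).root = a := if_pos hw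

theorem reroot_root_of_ne (hw : w ≠ T.root) : (T.reroot a w haw).root = T.root := if_neg hw

theorem reroot_parent_self_of_ne (hw : w ≠ T.root) :
    (T.reroot a w haw).parent a = T.parent w := by
  simp [reroot, rerootParent, hw]

theorem reroot_parent_of_not {z : V} (hz : ¬ (T.Desc a z ∧ T.Desc z w)) :
    (T.reroot a w haw).parent z = T.parent z := by
  have hza : z ≠ a := by
    rintro rfl
    exact hz ⟨T.desc_refl _, haw⟩
  simp [reroot, rerootParent, hza, hz]

theorem ne_root_of_desc {z : V} (hzw : T.Desc z w) (hne : z ≠ w) : z ≠ T.root := by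
  rintro rfl
  exact hne (eq_root_of_desc hzw).symm

/-- The edges of the path from `a` to `w` are reversed. -/
theorem reroot_parent_parent {z : V} (haz : T.Desc a z) (hzw : T.Desc z w) (hne : z ≠ w) :
    (T.reroot a w haw).parent (T.parent z) = z := by
  have hr := ne_root_of_desc hzw hne
  have h1 : T.parent z ≠ a := by
    intro he
    exact not_desc_parent hr (he ▸ haz)
  have h2 : T.Desc a (T.parent z) ∧ T.Desc (T.parent z) w :=
    ⟨haz.trans (T.desc_parent z), hzw.parent hne⟩
  simp only [reroot, rerootParent, if_neg h1, if_pos h2]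
  exact childToward_eq hr rfl haz

theorem exists_child_on_path {v : V} (hav : T.Desc a v) (hvw : T.Desc v w) (hne : v ≠ a) :
    ∃ u, T.Desc a u ∧ T.Desc u w ∧ u ≠ w ∧ u ≠ T.root ∧ T.parent u = v := by
  obtain ⟨u, h1, rfl, h3⟩ := exists_child_of_desc hav hne.symm
  refine ⟨u, h3, (T.desc_parent u).trans hvw, ?_, h1, rfl⟩
  rintro rfl
  exact not_desc_parent h1 hvw

include haw in
theorem ne_root_of_reroot (hw : w ≠ T.root) : a ≠ T.root := by
  rintro rfl
  exact hw (eq_root_of_desc haw)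

/-- Case analysis on the position of a node `v` that is not the root of the new tree. -/
theorem reroot_cases {v : V} (hv : v ≠ (T.reroot a w haw).root) :
    (v = a ∧ w ≠ T.root) ∨
    (∃ u, T.Desc a u ∧ T.Desc u w ∧ u ≠ w ∧ u ≠ T.root ∧ T.parent u = v) ∨
    (¬ (T.Desc a v ∧ T.Desc v w) ∧ v ≠ a ∧ v ≠ w ∧ v ≠ T.root) := by
  by_cases hva : v = a
  · subst hva
    exact Or.inl ⟨rfl, fun hw => hv (reroot_root_of_eq haw hw).symm⟩
  by_cases h : T.Desc a v ∧ T.Desc v w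
  · exact Or.inr (Or.inl (exists_child_on_path h.1 h.2 hva))
  · refine Or.inr (Or.inr ⟨h, hva, by
      rintro rfl
      exact h ⟨haw, T.desc_refl _⟩, fun hr => ?_⟩)
    by_cases hw : w = T.root
    · subst hr
      exact h ⟨hw ▸ haw, hw ▸ T.desc_refl _⟩
    · exact hv (hr.trans (reroot_root_of_ne haw hw).symm)

/-- A subtree off the path moves rigidly, and a proper ancestor of `w` keeps all of `T_w` below it.
-/
theorem reroot_desc_of_not {v z : V} (hz : ¬ (T.Desc a z ∧ T.Desc z w)) :
    (T.reroot a w haw).Desc v z ↔ T.Desc v z := by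
  have hza : a ≠ z := by
    rintro rfl
    exact hz ⟨T.desc_refl _, haw⟩
  have hzw : w ≠ z := by
    rintro rfl
    exact hz ⟨haw, T.desc_refl _⟩
  refine desc_iff_of_local (P := fun v => T.Desc v z) ?_ (fun v hv => ?_) v
  · by_cases hw : w = T.root
    · rw [reroot_root_of_eq haw hw]
      exact iff_of_false (fun hd => hz ⟨hd, hw ▸ T.desc_root z⟩) hza
    · rw [reroot_root_of_ne haw hw]
      exact ⟨fun h => (eq_root_of_desc h).symm, fun h => h ▸ T.desc_refl _⟩
  · rcases reroot_cases haw hv with ⟨rfl, hw⟩ | ⟨u, h1, h2, h3, h4, rfl⟩ | ⟨h1, h2, h3, h4⟩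
    · rw [reroot_parent_self_of_ne haw hw]
      constructor
      · intro hd
        exact Or.inr (((hd.total haw).resolve_left fun hh => hz ⟨hd, hh⟩).parent hzw)
      · rintro (hd | hd)
        · exact absurd hd hza
        · exact haw.trans ((T.desc_parent w).trans hd)
    · rw [reroot_parent_parent haw h1 h2 h3]
      constructor
      · exact fun hd => Or.inr ((T.desc_parent u).trans hd)
      · rintro (rfl | hd)
        · exact T.desc_refl _
        · exact hd.parent fun he => hz (he ▸ ⟨h1, h2⟩)
    · rw [reroot_parent_of_not haw h1]
      exact desc_iff_eq_or_parent

theorem reroot_desc_self {v : V} : (T.reroot a w haw).Desc v a ↔ T.Desc v w := by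
  refine desc_iff_of_local (P := fun v => T.Desc v w) ?_ (fun v hv => ?_) v
  · by_cases hw : w = T.root
    · rw [reroot_root_of_eq haw hw]
      exact iff_of_true haw rfl
    · rw [reroot_root_of_ne haw hw]
      exact iff_of_false (fun hd => hw (eq_root_of_desc hd)) (ne_root_of_reroot haw hw).symm
  · rcases reroot_cases haw hv with ⟨rfl, hw⟩ | ⟨u, h1, h2, h3, h4, rfl⟩ | ⟨h1, h2, h3, h4⟩
    · exact iff_of_true haw (Or.inl rfl)
    · rw [reroot_parent_parent haw h1 h2 h3]
      exact iff_of_true (h2.parent h3) (Or.inr h2)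
    · rw [reroot_parent_of_not haw h1, desc_iff_eq_or_parent]
      simp [h2, h3]

/-- Cutting the edge above `z` splits `T_w` in two; the part without `a` is what hangs below the old
father of `z` afterwards. -/
theorem reroot_desc_parent {v z : V} (haz : T.Desc a z) (hzw : T.Desc z w) (hne : z ≠ w) :
    (T.reroot a w haw).Desc v (T.parent z) ↔ T.Desc v w ∧ ¬ T.Desc v z := by
  have hzr := ne_root_of_desc hzw hne
  have haz' : a ≠ T.parent z := fun he => not_desc_parent hzr (he ▸ haz)
  refine desc_iff_of_local (P := fun v => T.Desc v w ∧ ¬ T.Desc v z) ?_ (fun v hv => ?_) v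
  · by_cases hw : w = T.root
    · rw [reroot_root_of_eq haw hw]
      exact iff_of_false (fun hd => hd.2 haz) haz'
    · rw [reroot_root_of_ne haw hw]
      refine iff_of_false (fun hd => hw (eq_root_of_desc hd.1)) fun he => ?_
      exact hw (eq_root_of_desc (he ▸ hzw.parent hne))
  · rcases reroot_cases haw hv with ⟨rfl, hw⟩ | ⟨u, h1, h2, h3, h4, rfl⟩ | ⟨h1, h2, h3, h4⟩
    · rw [reroot_parent_self_of_ne haw hw]
      refine iff_of_false (fun hd => hd.2 haz) ?_
      rintro (hd | hd)
      · exact haz' hd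
      · exact not_desc_parent hw hd.1
    · rw [reroot_parent_parent haw h1 h2 h3]
      constructor
      · intro hd
        by_cases huz : T.Desc u z
        · by_cases he : u = z
          · exact Or.inl (he ▸ rfl)
          · exact absurd (huz.parent he) hd.2
        · exact Or.inr ⟨h2, huz⟩
      · rintro (hd | hd)
        · exact ⟨h2.parent h3, hd ▸ not_desc_parent hzr⟩
        · exact ⟨h2.parent h3, fun hh => hd.2 ((T.desc_parent u).trans hh)⟩
    · rw [reroot_parent_of_not haw h1, desc_iff_eq_or_parent (z := w),
        desc_iff_eq_or_parent (z := z)]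
      have h5 : v ≠ z := fun he => h1 (he ▸ ⟨haz, hzw⟩)
      have h6 : v ≠ T.parent z := fun he =>
        h1 (he ▸ ⟨haz.trans (T.desc_parent z), hzw.parent hne⟩)
      simp [h3, h5, h6]

/-- Rerooting back restores the tree. -/
theorem reroot_reroot (h' : (T.reroot a w haw).Desc w a) :
    (T.reroot a w haw).reroot w a h' = T := by
  have hr : a = (T.reroot a w haw).root ↔ w = T.root := by
    by_cases hw : w = T.root
    · rw [reroot_root_of_eq haw hw]
      exact iff_of_true rfl hw
    · rw [reroot_root_of_ne haw hw]
      exact iff_of_false (ne_root_of_reroot haw hw) hw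
  ext z
  · by_cases hw : w = T.root
    · rw [reroot_root_of_eq h' (hr.2 hw), hw]
    · rw [reroot_root_of_ne h' (fun hh => hw (hr.1 hh)), reroot_root_of_ne haw hw]
  · by_cases hz : T.Desc a z ∧ T.Desc z w
    · by_cases hzw : z = w
      · subst hzw
        by_cases hw : z = T.root
        · have h1 := (reroot_root_of_eq h' (hr.2 hw))
          have h2 := ((T.reroot a z haw).reroot z a h').parent_root
          rw [h1] at h2
          rw [h2]
          nth_rw 2 [hw]
          rw [T.parent_root, hw]
        · rw [reroot_parent_self_of_ne h' (fun hh => hw (hr.1 hh)),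
            reroot_parent_self_of_ne haw hw]
      · have h1 : (T.reroot a w haw).Desc w (T.parent z) :=
          (reroot_desc_parent haw hz.1 hz.2 hzw).2
            ⟨T.desc_refl _, fun hh => hzw (hz.2.antisymm hh)⟩
        have h2 : (T.reroot a w haw).Desc (T.parent z) a :=
          (reroot_desc_self haw).2 (hz.2.parent hzw)
        have h3 : T.parent z ≠ a := fun he =>
          not_desc_parent (ne_root_of_desc hz.2 hzw) (he ▸ hz.1)
        have := reroot_parent_parent h' h1 h2 h3
        rwa [reroot_parent_parent haw hz.1 hz.2 hzw] at this
    · rw [reroot_parent_of_not h', reroot_parent_of_not haw hz]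
      rw [reroot_desc_of_not haw hz, reroot_desc_self haw]
      rintro ⟨h1, h2⟩
      exact hz (h1.antisymm h2 ▸ ⟨haw, T.desc_refl _⟩)

theorem deg_eq_zero_iff [Finite V] {v : V} :
    T.deg v = 0 ↔ ∀ z, z ≠ T.root → T.parent z ≠ v := by
  unfold deg
  rw [Set.ncard_eq_zero (Set.toFinite _), Set.eq_empty_iff_forall_notMem]
  simp

theorem reroot_deg_eq_zero [Finite V] {v : V} (hva : v ≠ a) (hvw : v ≠ w) (h : T.deg v = 0) :
    (T.reroot a w haw).deg v = 0 := by
  rw [deg_eq_zero_iff] at h ⊢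
  intro z hz
  rcases reroot_cases haw hz with ⟨rfl, hw⟩ | ⟨u, h1, h2, h3, h4, rfl⟩ | ⟨h1, h2, h3, h4⟩
  · rw [reroot_parent_self_of_ne haw hw]
    exact h w hw
  · rw [reroot_parent_parent haw h1 h2 h3]
    rintro rfl
    obtain ⟨u', _, _, _, h5, h6⟩ := exists_child_on_path h1 h2 hva
    exact h u' h5 h6
  · rw [reroot_parent_of_not haw h1]
    exact h z h4

theorem reroot_deg_eq_zero_iff [Finite V] {v : V} (hva : v ≠ a) (hvw : v ≠ w) :
    (T.reroot a w haw).deg v = 0 ↔ T.deg v = 0 := by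
  refine ⟨fun h => ?_, reroot_deg_eq_zero haw hva hvw⟩
  have h' : (T.reroot a w haw).Desc w a := (reroot_desc_self haw).2 (T.desc_refl w)
  have := reroot_deg_eq_zero h' hvw hva h
  rwa [reroot_reroot haw h'] at this

end Reroot

/-! ### The effect of the lowering -/

section Lower

theorem ncard_setOf_perm {α : Type*} (σ : Equiv.Perm α) (P : α → Prop) :
    {z | P (σ z)}.ncard = {z | P z}.ncard := by
  rw [← Set.ncard_image_of_injective {z | P (σ z)} σ.injective]
  congr 1
  ext z
  exact ⟨fun ⟨y, hy, he⟩ => he ▸ hy, fun hz => ⟨σ.symm z, by simpa using hz, by simp⟩⟩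

variable {V : Type*} [LinearOrder V] [Fintype V]

theorem beta_congr {T T' : LabelledTree V} {z z' : V} (h : ∀ v, T'.Desc v z ↔ T.Desc v z') :
    T'.beta z = T.beta z' :=
  le_antisymm (T'.beta_le ((h _).2 (T.beta_desc z'))) (T.beta_le ((h _).1 (T'.beta_desc z)))

variable [BoundedOrder V]

/-- The edge with child `y` is the first proper edge on the path from `⊤` to the root. -/
structure FirstProper (T : LabelledTree V) (y : V) : Prop where
  desc : T.Desc ⊤ y
  proper : T.ProperEdge y
  first : ∀ z, T.Desc ⊤ z → T.ProperEdge z → T.Desc y z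

theorem exists_firstProper {T : LabelledTree V} (h : T.properOnPath ⊤ ≠ 0) :
    ∃ y, T.FirstProper y := by
  obtain ⟨y, hy, hf⟩ := exists_first_ancestor (T := T) (v := ⊤) (P := T.ProperEdge)
    (Set.nonempty_of_ncard_ne_zero h)
  exact ⟨y, hy.1, hy.2, fun z h1 h2 => hf z ⟨h1, h2⟩⟩

namespace FirstProper

variable {T : LabelledTree V} {y : V} (h : T.FirstProper y)
include h

theorem desc_parent : T.Desc ⊤ (T.parent y) := h.desc.trans (T.desc_parent y)

theorem not_desc : ¬ T.Desc (T.parent y) y := not_desc_parent h.proper.1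

theorem top_ne : ⊤ ≠ T.parent y := fun he => h.not_desc (he ▸ h.desc)

theorem lower_eq : T.lower = T.reroot ⊤ (T.parent y) h.desc_parent := by
  have hex : ∃ w, T.IsUpperCritical w :=
    ⟨_, y, ⟨h.desc, h.proper⟩, fun z hz => h.first z hz.1 hz.2, rfl⟩
  have hw : hex.choose = T.parent y := by
    obtain ⟨y', h1, h2, h3⟩ := hex.choose_spec
    rw [← h3, (h2 y ⟨h.desc, h.proper⟩).antisymm (h.first y' h1.1 h1.2)]
  unfold lower
  rw [dif_pos hex]
  congr 1

theorem desc_of_on_path {z : V} (h1 : T.Desc ⊤ z) (h2 : T.Desc z (T.parent y))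
    (hz : z ≠ T.parent y) : T.Desc z y := by
  rcases h.desc.total h1 with hd | hd
  · by_cases he : y = z
    · exact he ▸ T.desc_refl _
    · exact absurd (h2.antisymm (hd.parent he)) hz
  · exact hd

theorem lt_of_desc {z : V} (hz : T.Desc z y) : T.parent y < z := h.proper.2.trans_le (T.beta_le hz)

theorem lower_parent_parent {z : V} (h1 : T.Desc ⊤ z) (h2 : T.Desc z y) :
    T.lower.parent (T.parent z) = z := by
  rw [h.lower_eq]
  refine reroot_parent_parent _ h1 (h2.trans (T.desc_parent y)) ?_
  rintro rfl
  exact h.not_desc h2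

theorem lower_desc_parent {v z : V} (h1 : T.Desc ⊤ z) (h2 : T.Desc z y) :
    T.lower.Desc v (T.parent z) ↔ T.Desc v (T.parent y) ∧ ¬ T.Desc v z := by
  rw [h.lower_eq]
  refine reroot_desc_parent _ h1 (h2.trans (T.desc_parent y)) ?_
  rintro rfl
  exact h.not_desc h2

theorem lower_desc_top {v : V} : T.lower.Desc v ⊤ ↔ T.Desc v (T.parent y) := by
  rw [h.lower_eq]
  exact reroot_desc_self _

/-- The nodes on the path from `⊤` to the upper critical node, except `⊤`. -/
theorem exists_on_path {z : V} (h1 : T.Desc ⊤ z) (h2 : T.Desc z (T.parent y)) (hz : z ≠ ⊤) :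
    ∃ u, T.Desc ⊤ u ∧ T.Desc u y ∧ u ≠ T.root ∧ T.parent u = z := by
  obtain ⟨u, h3, h4, h5, h6, h7⟩ := exists_child_on_path h1 h2 hz
  exact ⟨u, h3, h.desc_of_on_path h3 h4 h5, h6, h7⟩

theorem lower_properEdge_top :
    T.lower.ProperEdge ⊤ ↔ T.ProperEdge (T.parent y) := by
  have hb : T.lower.beta ⊤ = T.beta (T.parent y) := beta_congr fun v => h.lower_desc_top
  unfold ProperEdge
  rw [hb, h.lower_eq]
  by_cases hw : T.parent y = T.root
  · rw [reroot_root_of_eq _ hw]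
    exact iff_of_false (fun hh => hh.1 rfl) (fun hh => hh.1 hw)
  · rw [reroot_root_of_ne _ hw, reroot_parent_self_of_ne _ hw]
    simp [hw, ne_root_of_reroot h.desc_parent hw]

theorem lower_top_eq_root : ⊤ = T.lower.root ↔ T.parent y = T.root := by
  rw [h.lower_eq]
  by_cases hw : T.parent y = T.root
  · rw [reroot_root_of_eq _ hw]
    exact iff_of_true rfl hw
  · rw [reroot_root_of_ne _ hw]
    exact iff_of_false (ne_root_of_reroot h.desc_parent hw) hw

theorem lower_properEdge_of_not {z : V} (hz : ¬ (T.Desc ⊤ z ∧ T.Desc z (T.parent y))) :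
    T.lower.ProperEdge z ↔ T.ProperEdge z := by
  have hb : T.lower.beta z = T.beta z := by
    rw [h.lower_eq]
    exact beta_congr fun v => reroot_desc_of_not _ hz
  unfold ProperEdge
  rw [hb, h.lower_eq, reroot_parent_of_not _ hz]
  refine and_congr_left fun _ => ?_
  by_cases hw : T.parent y = T.root
  · rw [reroot_root_of_eq _ hw]
    refine iff_of_true ?_ ?_
    · rintro rfl
      exact hz ⟨T.desc_refl _, h.desc_parent⟩
    · rintro rfl
      exact hz ⟨hw ▸ h.desc_parent, hw ▸ T.desc_refl _⟩
  · rw [reroot_root_of_ne _ hw]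

theorem lower_root_of_not {z : V} (hz : ¬ (T.Desc ⊤ z ∧ T.Desc z (T.parent y))) :
    z ≠ T.lower.root ↔ z ≠ T.root := by
  rw [h.lower_eq]
  by_cases hw : T.parent y = T.root
  · rw [reroot_root_of_eq _ hw]
    refine iff_of_true ?_ ?_
    · rintro rfl
      exact hz ⟨T.desc_refl _, h.desc_parent⟩
    · rintro rfl
      exact hz ⟨hw ▸ h.desc_parent, hw ▸ T.desc_refl _⟩
  · rw [reroot_root_of_ne _ hw]

theorem lower_improperEdge_on_path {z : V} (h1 : T.Desc ⊤ z) (h2 : T.Desc z (T.parent y))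
    (hz : z ≠ ⊤) : T.lower.ImproperEdge z := by
  obtain ⟨u, h3, h4, h5, rfl⟩ := h.exists_on_path h1 h2 hz
  have hp := h.lower_parent_parent h3 h4
  refine ⟨ne_root_of_parent_ne (by rw [hp]; exact (parent_ne h5).symm), ?_⟩
  rw [hp, not_lt]
  have hd : T.lower.Desc (T.parent y) (T.parent u) :=
    (h.lower_desc_parent h3 h4).2 ⟨T.desc_refl _, fun hh => h.not_desc (hh.trans h4)⟩
  exact (beta_le _ hd).trans (h.lt_of_desc h4).le

/-- Edges are indexed by their children: on the path, every node but `w` before and every node but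
`⊤` after. Swapping `⊤` and `w` matches the two indexings, and only the edge of `y` changes type.
The edge above `T_w` passes from `w` to `⊤` with the same father and the same `β`. -/
theorem lower_improperEdge_iff (z : V) : T.lower.ImproperEdge z ↔
    z = Equiv.swap ⊤ (T.parent y) y ∨ T.ImproperEdge (Equiv.swap ⊤ (T.parent y) z) := by
  have key : ∀ (S : LabelledTree V) z, S.ImproperEdge z ↔ z ≠ S.root ∧ ¬ S.ProperEdge z :=
    fun S z => by unfold ImproperEdge ProperEdge; tauto
  have hyw : y ≠ T.parent y := (parent_ne h.proper.1).symm
  by_cases hzt : z = ⊤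
  · subst hzt
    rw [key, key, Equiv.swap_apply_left, h.lower_properEdge_top, Ne, Ne, h.lower_top_eq_root]
    have : ⊤ ≠ Equiv.swap ⊤ (T.parent y) y := by
      intro he
      have := congrArg (Equiv.swap ⊤ (T.parent y)) he
      rw [Equiv.swap_apply_left, Equiv.swap_apply_self] at this
      exact hyw this.symm
    simp [this]
  by_cases hz : T.Desc ⊤ z ∧ T.Desc z (T.parent y)
  · refine iff_of_true (h.lower_improperEdge_on_path hz.1 hz.2 hzt) ?_
    by_cases hzw : z = T.parent y
    · subst hzw
      rw [Equiv.swap_apply_right]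
      by_cases hyt : y = ⊤
      · left
        nth_rw 3 [hyt]
        rw [Equiv.swap_apply_left]
      · right
        rw [key]
        refine ⟨ne_root_of_desc h.desc (Ne.symm hyt), fun hp => ?_⟩
        exact hyt ((h.first ⊤ (T.desc_refl _) hp).antisymm h.desc)
    · rw [Equiv.swap_apply_of_ne_of_ne hzt hzw]
      by_cases hzy : z = y
      · subst hzy
        exact Or.inl (Equiv.swap_apply_of_ne_of_ne hzt hzw).symm
      · right
        rw [key]
        refine ⟨ne_root_of_desc hz.2 hzw, fun hp => hzy ?_⟩
        exact (h.desc_of_on_path hz.1 hz.2 hzw).antisymm (h.first z hz.1 hp)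
  · have hzw : z ≠ T.parent y := by
      rintro rfl
      exact hz ⟨h.desc_parent, T.desc_refl _⟩
    rw [Equiv.swap_apply_of_ne_of_ne hzt hzw, key, key, h.lower_properEdge_of_not hz,
      h.lower_root_of_not hz]
    have : z ≠ Equiv.swap ⊤ (T.parent y) y := by
      by_cases hyt : y = ⊤
      · nth_rw 2 [hyt]
        rwa [Equiv.swap_apply_left]
      · rw [Equiv.swap_apply_of_ne_of_ne hyt hyw]
        rintro rfl
        exact hz ⟨h.desc, T.desc_parent _⟩
    simp [this]

theorem lower_improperCount : T.lower.improperCount = T.improperCount + 1 := by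
  unfold improperCount
  rw [← ncard_setOf_perm (Equiv.swap ⊤ (T.parent y)) T.ImproperEdge,
    ← Set.ncard_insert_of_notMem (a := Equiv.swap ⊤ (T.parent y) y) _ (Set.toFinite _)]
  · congr 1
    ext z
    exact h.lower_improperEdge_iff z
  · simp only [Set.mem_ofPred_eq, Equiv.swap_apply_self]
    exact fun hh => hh.2 h.proper.2

theorem lower_desc_proper_iff (z : V) : (T.lower.Desc ⊤ z ∧ T.lower.ProperEdge z) ↔
    T.Desc (T.parent y) (Equiv.swap ⊤ (T.parent y) z) ∧
      T.ProperEdge (Equiv.swap ⊤ (T.parent y) z) := by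
  by_cases hzt : z = ⊤
  · subst hzt
    rw [Equiv.swap_apply_left, h.lower_properEdge_top]
    simp [desc_refl]
  by_cases hz : T.Desc ⊤ z ∧ T.Desc z (T.parent y)
  · refine iff_of_false (fun hh => ?_) (fun hh => ?_)
    · exact (h.lower_improperEdge_on_path hz.1 hz.2 hzt).2 hh.2.2
    · by_cases hzw : z = T.parent y
      · subst hzw
        rw [Equiv.swap_apply_right] at hh
        exact h.not_desc (hh.1.trans h.desc)
      · rw [Equiv.swap_apply_of_ne_of_ne hzt hzw] at hh
        exact hzw (hz.2.antisymm hh.1)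
  · have hzw : z ≠ T.parent y := by
      rintro rfl
      exact hz ⟨h.desc_parent, T.desc_refl _⟩
    rw [Equiv.swap_apply_of_ne_of_ne hzt hzw, h.lower_properEdge_of_not hz]
    refine and_congr_left fun _ => ?_
    rw [h.lower_eq, reroot_desc_of_not _ hz]
    exact ⟨fun hd => (hd.total h.desc_parent).resolve_left fun hh => hz ⟨hd, hh⟩,
      h.desc_parent.trans⟩

theorem properOnPath_eq : T.properOnPath ⊤ = T.lower.properOnPath ⊤ + 1 := by
  unfold properOnPath
  simp only [h.lower_desc_proper_iff]
  rw [ncard_setOf_perm (Equiv.swap ⊤ (T.parent y))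
      (fun z => T.Desc (T.parent y) z ∧ T.ProperEdge z),
    ← Set.ncard_insert_of_notMem (a := y) (fun hh => h.not_desc hh.1) (Set.toFinite _)]
  congr 1
  ext z
  simp only [Set.mem_insert_iff, Set.mem_ofPred_eq]
  constructor
  · rintro ⟨h1, h2⟩
    by_cases hz : z = y
    · exact Or.inl hz
    · exact Or.inr ⟨(h.first z h1 h2).parent (Ne.symm hz), h2⟩
  · rintro (rfl | hh)
    · exact ⟨h.desc, h.proper⟩
    · exact ⟨h.desc_parent.trans hh.1, hh.2⟩

/-- The old father of `⊤` becomes its child; the old children of `⊤` are off the path and remain. -/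
theorem lower_deg_top : T.lower.deg ⊤ = T.deg ⊤ + 1 := by
  have htr : (⊤ : V) ≠ T.root := by
    intro he
    have h1 := h.desc
    rw [he] at h1
    exact h.proper.1 (eq_root_of_desc h1)
  have htp := h.lower_parent_parent (T.desc_refl _) h.desc
  unfold deg
  rw [← Set.ncard_insert_of_notMem (a := T.parent ⊤) (fun hh => ?_) (Set.toFinite _)]
  · congr 1
    ext z
    simp only [Set.mem_insert_iff, Set.mem_ofPred_eq]
    constructor
    · rintro ⟨h1, h2⟩
      have h3 := h1
      rw [h.lower_eq] at h3
      rcases reroot_cases _ h3 with ⟨rfl, _⟩ | ⟨u, h4, h5, h6, h7, rfl⟩ | ⟨h4, h5, h6, h7⟩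
      · exact absurd h2 (parent_ne h1)
      · rw [h.lower_parent_parent h4 (h.desc_of_on_path h4 h5 h6)] at h2
        exact Or.inl (by rw [h2])
      · rw [h.lower_eq, reroot_parent_of_not _ h4] at h2
        exact Or.inr ⟨h7, h2⟩
    · rintro (rfl | ⟨h1, h2⟩)
      · exact ⟨ne_root_of_parent_ne (by rw [htp]; exact (parent_ne htr).symm), htp⟩
      · have hz : ¬ (T.Desc ⊤ z ∧ T.Desc z (T.parent y)) := fun hh =>
          not_desc_parent h1 (h2.symm ▸ hh.1)
        refine ⟨(h.lower_root_of_not hz).2 h1, ?_⟩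
        rw [h.lower_eq, reroot_parent_of_not _ hz, h2]
  · have := (T.desc_parent (T.parent ⊤))
    rw [hh.2] at this
    exact not_desc_parent htr this

/-- What lies below `⊤` but not below `w` in the new tree is `T_y`, and `w` is smaller than all of
it. An earlier candidate would be the father of a proper edge before `y` on the old path. -/
theorem lower_isLowerCritical : T.lower.IsLowerCritical (T.parent y) := by
  have hbt : T.lower.beta ⊤ = T.beta (T.parent y) := beta_congr fun v => h.lower_desc_top
  have hb : T.lower.Desc (T.lower.beta ⊤) (T.parent y) := by
    rw [h.lower_desc_parent h.desc (T.desc_refl _), hbt]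
    exact ⟨T.beta_desc _, fun hd =>
      absurd (h.lt_of_desc hd) (not_lt.2 (T.beta_le_self _))⟩
  refine ⟨⟨h.top_ne.symm, h.lower_desc_top.2 (T.desc_refl _), hb, fun z h1 h2 => ?_⟩,
    fun u hu => ?_⟩
  · rw [h.lower_desc_top] at h1
    rw [h.lower_desc_parent h.desc (T.desc_refl _)] at h2
    exact h.lt_of_desc (not_not.1 fun hh => h2 ⟨h1, hh⟩)
  · obtain ⟨h1, h2, h3, h4⟩ := hu
    refine (h3.total hb).elim id fun hd => ?_
    rw [h.lower_desc_top] at h2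
    by_cases hp : T.Desc ⊤ u ∧ T.Desc u (T.parent y)
    · obtain ⟨v, h5, h6, h7, rfl⟩ := h.exists_on_path hp.1 hp.2 h1
      have hv : T.ProperEdge v := by
        refine ⟨h7, h4 _ ?_ ?_⟩
        · exact h.lower_desc_top.2 ((T.beta_desc v).trans (h6.trans (T.desc_parent y)))
        · rw [h.lower_desc_parent h5 h6]
          exact fun hh => hh.2 (T.beta_desc v)
      have hvy := h6.antisymm (h.first v h5 hv)
      exact hvy ▸ desc_refl _ _
    · rw [h.lower_eq, reroot_desc_of_not _ hp] at hd
      exact absurd ⟨h.desc_parent.trans hd, h2⟩ hp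

theorem lower_reroot (hd : T.lower.Desc (T.parent y) ⊤) :
    T.lower.reroot (T.parent y) ⊤ hd = T := by
  -- A variable `S` in place of `T.lower` allows substitution although `hd` depends on the tree.
  have key : ∀ (S : LabelledTree V) (hS : S = T.reroot ⊤ (T.parent y) h.desc_parent)
      (hd : S.Desc (T.parent y) ⊤), S.reroot (T.parent y) ⊤ hd = T := by
    rintro S rfl hd
    exact reroot_reroot h.desc_parent hd
  exact key _ h.lower_eq hd

theorem lower_deg_eq_zero_iff {v : V} (hvt : v ≠ ⊤) (hv : v ≠ T.parent y) :
    T.lower.deg v = 0 ↔ T.deg v = 0 := by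
  rw [h.lower_eq]
  exact reroot_deg_eq_zero_iff _ hvt hv

theorem parent_ne_of_deg_eq_zero {v : V} (hv : T.deg v = 0) : v ≠ T.parent y :=
  (deg_eq_zero_iff.1 hv y h.proper.1).symm

/-- All of `T_⊤` lies in `T_y`, hence above the father of `y`, so no node of it is `⊥`. -/
theorem lowerCriticalGtOne (hd : 0 < T.deg ⊤) : T.LowerCriticalGtOne := by
  obtain ⟨u, hu, -⟩ := T.existsUnique_isLowerCritical hd
  refine ⟨u, hu, bot_lt_iff_ne_bot.2 fun hb => ?_⟩
  have h1 := h.lt_of_desc (hu.1.2.1.trans h.desc)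
  rw [hb] at h1
  exact not_lt_bot h1

end FirstProper

/-! ### Inverting the lowering at the lower critical node -/

theorem IsLowerCritical.unique {T : LabelledTree V} {u v : V} (hu : T.IsLowerCritical u)
    (hv : T.IsLowerCritical v) : u = v :=
  (hv.2 u hu.1).antisymm (hu.2 v hv.1)

/-- Rerooting the subtree at `⊤` at the lower critical node inverts the lowering. -/
theorem IsLowerCritical.firstProper {T : LabelledTree V} {u : V} (hu : T.IsLowerCritical u) :
    (T.reroot u ⊤ hu.1.2.1).FirstProper (T.parent u) ∧
      (T.reroot u ⊤ hu.1.2.1).parent (T.parent u) = u := by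
  obtain ⟨⟨h1, h2, h3, h4⟩, h5⟩ := hu
  have hp : (T.reroot u ⊤ h2).parent (T.parent u) = u :=
    reroot_parent_parent h2 (T.desc_refl _) h2 h1
  have hd : ∀ v, (T.reroot u ⊤ h2).Desc v (T.parent u) ↔ T.Desc v ⊤ ∧ ¬ T.Desc v u :=
    fun v => reroot_desc_parent h2 (T.desc_refl _) h2 h1
  have hur := ne_root_of_desc h2 h1
  have ht : (T.reroot u ⊤ h2).Desc ⊤ (T.parent u) :=
    (hd ⊤).2 ⟨T.desc_refl _, fun hh => h1 (h2.antisymm hh)⟩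
  refine ⟨⟨ht, ⟨ne_root_of_parent_ne (by rw [hp]; exact (parent_ne hur).symm), ?_⟩,
    fun z hz hpz => ?_⟩, hp⟩
  · rw [hp]
    have := (hd _).1 ((T.reroot u ⊤ h2).beta_desc (T.parent u))
    exact h4 _ this.1 this.2
  · refine (ht.total hz).elim id fun hzd => ?_
    obtain ⟨h6, h7⟩ := (hd z).1 hzd
    by_cases hon : T.Desc u z ∧ T.Desc z ⊤
    · obtain ⟨v, h8, h9, h10, h11, rfl⟩ := exists_child_on_path hon.1 hon.2
        (fun he => h7 (he ▸ T.desc_refl _))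
      -- A proper edge before the reversed edge of `u` would give a candidate before `u`.
      have hv : T.LowerCandidate v := by
        refine ⟨h10, h9, h3.trans h8, fun x hx hxv => ?_⟩
        have h12 : (T.reroot u ⊤ h2).Desc x (T.parent v) :=
          (reroot_desc_parent h2 h8 h9 h10).2 ⟨hx, hxv⟩
        have h13 := hpz.2
        rw [reroot_parent_parent h2 h8 h9 h10] at h13
        exact h13.trans_le (beta_le _ h12)
      rw [(h5 v hv).antisymm h8]
      exact desc_refl _ _
    · rw [reroot_desc_of_not h2 hon] at hz
      exact absurd (hz.antisymm h6 ▸ ⟨h2, T.desc_refl _⟩) hon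

/-- A tree in which `⊤` has a lower critical node is the lowering of a tree. -/
theorem IsLowerCritical.exists_lower_eq {T : LabelledTree V} {u : V} (hu : T.IsLowerCritical u) :
    ∃ S : LabelledTree V, ∃ y, S.FirstProper y ∧ S.parent y = u ∧ S.lower = T := by
  obtain ⟨h1, h2⟩ := hu.firstProper
  refine ⟨_, _, h1, h2, ?_⟩
  rw [h1.lower_eq]
  have key : ∀ v (hv : (T.reroot u ⊤ hu.1.2.1).Desc ⊤ v), v = u →
      (T.reroot u ⊤ hu.1.2.1).reroot ⊤ v hv = T := by
    rintro v hv rfl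
    exact reroot_reroot hu.1.2.1 hv
  exact key _ _ h2

/-- The lower critical node of the image is the upper critical node of the source. Hence `λ > 1`
says that the latter is not `⊥`, which `deg ⊥ = 0` forces in the source and which lets `deg ⊥ = 0`
pass back from the image. -/
theorem bijOn_lower (k i d : ℕ) :
    Set.BijOn (lower (V := V))
      {T | T.improperCount = k ∧ T.properOnPath ⊤ = i + 1 ∧ T.deg ⊥ = 0 ∧ d ≤ T.deg ⊤}
      {T | T.improperCount = k + 1 ∧ T.properOnPath ⊤ = i ∧ T.deg ⊥ = 0 ∧ d + 1 ≤ T.deg ⊤ ∧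
        T.LowerCriticalGtOne} := by
  have hbt : ∀ {T : LabelledTree V} {y}, T.FirstProper y → (⊥ : V) ≠ ⊤ := fun {T y} h he =>
    h.top_ne (le_antisymm (he ▸ bot_le) le_top)
  refine ⟨?_, ?_, ?_⟩
  · rintro T ⟨h1, h2, h3, h4⟩
    obtain ⟨y, h⟩ := exists_firstProper (T := T) (by omega)
    have hb := h.parent_ne_of_deg_eq_zero h3
    refine ⟨by rw [h.lower_improperCount, h1], ?_,
      (h.lower_deg_eq_zero_iff (hbt h) hb).2 h3, by rw [h.lower_deg_top]; omega,
      _, h.lower_isLowerCritical, bot_lt_iff_ne_bot.2 hb.symm⟩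
    have := h.properOnPath_eq
    omega
  · rintro T ⟨-, h2, -⟩ T' ⟨-, h2', -⟩ he
    obtain ⟨y, h⟩ := exists_firstProper (T := T) (by omega)
    obtain ⟨y', h'⟩ := exists_firstProper (T := T') (by omega)
    have hw : T.parent y = T'.parent y' :=
      h.lower_isLowerCritical.unique (he ▸ h'.lower_isLowerCritical)
    have key : ∀ (S S' : LabelledTree V) (u u' : V) (hS : S.Desc u ⊤) (hS' : S'.Desc u' ⊤),
        S = S' → u = u' → S.reroot u ⊤ hS = S'.reroot u' ⊤ hS' := by
      rintro S _ u _ _ _ rfl rfl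
      rfl
    rw [← h.lower_reroot h.lower_isLowerCritical.1.2.1,
      ← h'.lower_reroot h'.lower_isLowerCritical.1.2.1]
    exact key _ _ _ _ _ _ he hw
  · rintro T ⟨h1, h2, h3, h4, u, hu, hub⟩
    obtain ⟨S, y, h, rfl, rfl⟩ := hu.exists_lower_eq
    rw [h.lower_improperCount] at h1
    rw [h.lower_deg_top] at h4
    have := h.properOnPath_eq
    exact ⟨S, ⟨by omega, by omega, (h.lower_deg_eq_zero_iff (hbt h) hub.ne).1 h3, by omega⟩, rfl⟩

end Lower
end LabelledTree

/-! ### The three statements -/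

open LabelledTree

/-- With a proper edge on the path, `λ > 1` is automatic; so the target of one lowering can serve as
the source of the next. -/
theorem treesLambda_succ (n k i d : ℕ) [NeZero n] : treesLambda n k (i + 1) (d + 1) =
    {T | T.improperCount = k ∧ T.properOnPath ⊤ = i + 1 ∧ T.deg ⊥ = 0 ∧ d + 1 ≤ T.deg ⊤} := by
  ext T
  constructor
  · rintro ⟨⟨h1, h2⟩, h3, h4, -⟩
    exact ⟨h1, h2, h3, h4⟩
  · rintro ⟨h1, h2, h3, h4⟩
    obtain ⟨y, h⟩ := exists_firstProper (T := T) (by omega)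
    exact ⟨⟨h1, h2⟩, h3, h4, h.lowerCriticalGtOne (by omega)⟩

theorem bijOn_lower_treesLambda (n k i d : ℕ) [NeZero n] :
    Set.BijOn lower
      {T | T.improperCount = k ∧ T.properOnPath ⊤ = i + 1 ∧ T.deg ⊥ = 0 ∧ d ≤ T.deg ⊤}
      (treesLambda n (k + 1) i (d + 1)) := by
  convert bijOn_lower (V := Fin n) k i d using 1
  ext T
  simp only [treesLambda, treesR, Set.mem_ofPred_eq, and_assoc]

theorem bijOn_iterate_lower (n k i d j : ℕ) [NeZero n] :
    Set.BijOn lower^[j] (treesLambda n k (i + j) (d + 1)) (treesLambda n (k + j) i (d + 1 + j)) := by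
  induction j generalizing k d with
  | zero => exact Set.bijOn_id _
  | succ j ih =>
    have h1 := bijOn_lower_treesLambda n k (i + j) (d + 1)
    rw [← treesLambda_succ] at h1
    have h2 := (ih (k + 1) (d + 1)).comp h1
    rw [Function.iterate_succ]
    convert h2 using 2 <;> omega

theorem mainTheorem6 (n k m : ℕ) [NeZero n] (hm : 1 ≤ m) :
    Nonempty (treesDegOne n k m ≃ treesLambda n (k + m) 0 m) ∧
    Set.BijOn (LabelledTree.lower^[m - 1])
      (treesLambda n (k + 1) (m - 1) 1) (treesLambda n (k + m) 0 m) ∧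
    (Nonempty (treesDegOne n k m ≃ treesLambda n (k + 1) (m - 1) 1) ↔
      Nonempty (treesDegOne n k m ≃ treesLambda n (k + m) 0 m)) := by
  obtain ⟨m, rfl⟩ : ∃ j, m = j + 1 := ⟨m - 1, by omega⟩
  have hbij : Set.BijOn (LabelledTree.lower^[m]) (treesLambda n (k + 1) m 1)
      (treesLambda n (k + (m + 1)) 0 (m + 1)) := by
    have h := bijOn_iterate_lower n (k + 1) 0 0 m
    rw [Nat.zero_add, Nat.zero_add, Nat.add_assoc, Nat.add_comm 1 m] at h
    exact h
  have e2 := hbij.equiv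
  refine ⟨?_, hbij, fun ⟨e⟩ => ⟨e.trans e2⟩, fun ⟨e⟩ => ⟨e.trans e2.symm⟩⟩
  -- The first of the `m + 1` lowerings starts without a condition on `deg ⊤`, whence `d = 0`; `e2`
  -- performs the other `m`.
  have e1 := (bijOn_lower_treesLambda n k m 0).equiv
  obtain ⟨e⟩ := nonempty_equiv_separatedTrees (V := Fin n) k 0 0 (m + 1)
  rw [Nat.zero_add] at e
  have h1 : treesDegOne n k (m + 1) = separatedTrees (Fin n) k 0 (m + 1) := by
    ext T
    rw [mem_separatedTrees_zero_left (Nat.succ_ne_zero m)]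
    simp only [treesDegOne, treesR, Set.mem_ofPred_eq, and_assoc]
  have h2 : separatedTrees (Fin n) k (m + 1) 0 = {T | T.improperCount = k ∧
      T.properOnPath ⊤ = m + 1 ∧ T.deg ⊥ = 0 ∧ 0 ≤ T.deg ⊤} := by
    ext T
    rw [mem_separatedTrees_zero_right (Nat.succ_ne_zero m)]
    simp
  rw [h1]
  rw [h2] at e
  exact ⟨e.symm.trans (e1.trans e2)⟩
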